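/- Let $M\ge 2$, let $(p_1,\dots,p_M)$ be a probability vector with $p_i\in(0,1)$ and let $s_1,\dots,s_M>0$. Call $f:\mathbb R\to\mathbb R$ directly Riemann integrable if for all sufficiently small $h>0$ it is bounded on each $[(k-1)h,kh)$, $k\in\mathbb Z$, the series $\sum_{k\in\mathbb Z}h\inf_{[(k-1)h,kh)}f$ and $\sum_{k\in\mathbb Z}h\sup_{[(k-1)h,kh)}f$ converge absolutely, and both sums tend to the same finite limit as $h\downarrow0$. Let $z:\mathbb R\to\mathbb R$ be directly Riemann integrable with $z(t)\le C e^{rt}$ for all $t<0$, for some constants $C,r>0$. Put $$Z(t)=\sum_{n=0}^{\infty}\ \sum_{\omega\in\{1,\dots,M\}^n} z(t-s_{\omega_1}-\cdots-s_{\omega_n})\,p_{\omega_1}\cdots p_{\omega_n},\qquad t\in\mathbb R .$$ Then $z$ is Lebesgue integrable, the series converges absolutely for every $t$ (as a sum over all finite words $\omega$), and $Z$ solves the renewal equation $Z(t)=\sum_{i=1}^M Z(t-s_i)p_i+z(t)$, $t\in\mathbb R$. Here $f\sim g$ means that for every $\varepsilon>0$ one has $|f(t)-g(t)|\le\varepsilon|g(t)|$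 for all sufficiently large $t$. Moreover: 1. (Non-lattice case.) If $\{s_1,\dots,s_M\}$ is not contained in a discrete subgroup of $\mathbb R$, then $$\lim_{t\to\infty}Z(t)=\frac{1}{\sum_{i}p_is_i}\int_{-\infty}^{\infty}z(T)\,dT;$$ if $\int z\neq0$, then $Z(t)\sim \frac{1}{\sum_i p_is_i}\int_{-\infty}^\infty z(T)\,dT$ as $t\to\infty$. 2. (Lattice case.) If $a>0$ is the largest number with $\{s_1,\dots,s_M\}\subset a\mathbb Z$, then $\sum_{l\in\mathbb Z}z(al+t)$ converges absolutely for every $t\in\mathbb R$ and, with $G(t)=\frac{a}{\sum_{i}p_is_i}\sum_{l=-\infty}^{\infty}z(al+t)$, $$\lim_{t\to\infty}\bigl(Z(t)-G(t)\bigr)=0;$$ moreover, for every $c>0$, $Z(t)\sim G(t)$ as $t\to\infty$ within the set $\{t:\ |G(t)|\ge c\}$. 3. In all cases $Z$ is integrable on bounded intervals and $$\lim_{t\to\infty}\frac1t\int_0^tZ(T)\,dT=\frac{1}{\sum_{i}p_is_i}\int_{-\infty}^{\infty}z(T)\,dT .$$ -/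

import Mathlib

open Filter Topology MeasureTheory Asymptotics

noncomputable section

namespace KeyRenewal

/-- Infimum of `f` over the half-open block `[(k-1)h, kh)`. -/
def lowerBlock (f : ℝ → ℝ) (h : ℝ) (k : ℤ) : ℝ :=
  sInf (f '' Set.Ico (((k : ℝ) - 1) * h) ((k : ℝ) * h))

/-- Supremum of `f` over the half-open block `[(k-1)h, kh)`. -/
def upperBlock (f : ℝ → ℝ) (h : ℝ) (k : ℤ) : ℝ :=
  sSup (f '' Set.Ico (((k : ℝ) - 1) * h) ((k : ℝ) * h))

/-- Lower Riemann sum of `f` over the whole real line with mesh `h`. -/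
def lowerSum (f : ℝ → ℝ) (h : ℝ) : ℝ := ∑' k : ℤ, h * lowerBlock f h k

/-- Upper Riemann sum of `f` over the whole real line with mesh `h`. -/
def upperSum (f : ℝ → ℝ) (h : ℝ) : ℝ := ∑' k : ℤ, h * upperBlock f h k

/-- Direct Riemann integrability on `ℝ`: for all small meshes `h > 0` the block infima and suprema
are finite real numbers (that is, `f` is bounded on each block), the lower and upper Riemann sums
over the whole line converge absolutely, and both tend to the same limit as `h → 0`. -/
def DirectlyRiemannIntegrable (f : ℝ → ℝ) : Prop :=
  (∀ᶠ h in 𝓝[>] (0 : ℝ),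
    (∀ k : ℤ, BddBelow (f '' Set.Ico (((k : ℝ) - 1) * h) ((k : ℝ) * h)) ∧
      BddAbove (f '' Set.Ico (((k : ℝ) - 1) * h) ((k : ℝ) * h))) ∧
    Summable (fun k : ℤ => h * lowerBlock f h k) ∧
    Summable (fun k : ℤ => h * upperBlock f h k)) ∧
  ∃ L : ℝ, Tendsto (lowerSum f) (𝓝[>] 0) (𝓝 L) ∧ Tendsto (upperSum f) (𝓝[>] 0) (𝓝 L)

/-- The contribution `∑_{ω ∈ {1,…,M}ⁿ} z(t - s_ω) p_ω` of the words of length `n`, where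
`s_ω = s_{ω₁} + ⋯ + s_{ωₙ}` and `p_ω = p_{ω₁} ⋯ p_{ωₙ}`. -/
def levelSum {M : ℕ} (p s : Fin M → ℝ) (z : ℝ → ℝ) (n : ℕ) (t : ℝ) : ℝ :=
  ∑ ω : Fin n → Fin M, z (t - ∑ j, s (ω j)) * ∏ j, p (ω j)

/-- The renewal function `Z(t) = ∑_{n ≥ 0} ∑_{ω ∈ {1,…,M}ⁿ} z(t - s_ω) p_ω`. -/
def renewalFunction {M : ℕ} (p s : Fin M → ℝ) (z : ℝ → ℝ) (t : ℝ) : ℝ :=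
  ∑' n : ℕ, levelSum p s z n t

/-- The mean interarrival time `∑ p_i s_i`. -/
def mean {M : ℕ} (p s : Fin M → ℝ) : ℝ := ∑ i, p i * s i

/-- The periodic function `t ↦ a / (∑ p_i s_i) * ∑_{l ∈ ℤ} z(al + t)`. -/
def latticeLimit {M : ℕ} (p s : Fin M → ℝ) (z : ℝ → ℝ) (a : ℝ) (t : ℝ) : ℝ :=
  a / mean p s * ∑' l : ℤ, z (a * (l : ℝ) + t)

end KeyRenewal

end

/-!
Write `U = ∑_ω p_ω δ_{s_ω}` for the renewal measure, so that `Z = U * z` (`wordSum`). The whole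
argument is elementary and rests on three facts.

*Uniform bound.* The `U`-measure of an interval is bounded by a constant depending only on its
length (`exists_wordSum_blockIndicator_le`): `arctan + π / 2` is a bounded supersolution of the
renewal equation. Consequently, if `|z|` lies below a step function with summable heights, the
series for `Z` converges absolutely and `Z` is bounded and tends to `0` at `-∞`. A directly Riemann
integrable function has such a bound at every mesh.

*Averages.* Integrating the renewal equation gives
`∑ p_i ∫_{x - s_i}^x Z = ∫_{-∞}^x z → ∫ z`. Comparing the primitive of `Z` with linear functions by
the maximum principle `le_of_forall_window_le` yields the limit of `t⁻¹ ∫_0^t Z`. If `Z`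
converges, this also identifies its limit as `(∫ z) / ∑ p_i s_i`.

*Convergence.* If `z` vanishes near `+∞`, then `Z` is eventually a weighted average of its own earlier
values. Where `Z` is close to its limit superior, it must be so at all points reached by short
words. Far out, the shifts of words have gaps bounded by any prescribed positive element of the
group generated by the `s_i` (`exists_wordShift_mem_Ioc`), so these points fill a whole window up to
an error that `Z` does not see, and by the maximum principle `Z` stays close to its limit
superior forever (`exists_tendsto_of_homogeneous`). In the non-lattice case the gaps are
arbitrarily small, and the argument applies to compactly supported Lipschitz `z`, for which `Z`
is uniformly continuous; in the lattice case the gap is the span `a`, and it applies to the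
indicator function of `[0, a)`, for which `Z` is constant on blocks of length `a`.

Dominated convergence for sums passes from blocks to step functions, and a sandwich between lower and
upper step functions to `z`. In the lattice case `Z - G` is directly a dominated series over the
lattice coset of `t`.
-/

namespace KeyRenewal

/-! ### Sums over finite words -/

/-- The displacement `s_ω = s_{ω₁} + ⋯ + s_{ωₙ}` of a finite word. -/
def wordShift {M : ℕ} (s : Fin M → ℝ) (w : (n : ℕ) × (Fin n → Fin M)) : ℝ := ∑ j, s (w.2 j)

/-- The weight `p_ω = p_{ω₁} ⋯ p_{ωₙ}` of a finite word. -/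
def wordWeight {M : ℕ} (p : Fin M → ℝ) (w : (n : ℕ) × (Fin n → Fin M)) : ℝ := ∏ j, p (w.2 j)

/-- The convolution of `z` with the renewal measure `∑_ω p_ω δ_{s_ω}`, as one unordered sum over
all finite words. It agrees with `renewalFunction` whenever the sum converges. -/
noncomputable def wordSum {M : ℕ} (p s : Fin M → ℝ) (z : ℝ → ℝ) (t : ℝ) : ℝ :=
  ∑' w, z (t - wordShift s w) * wordWeight p w

/-- The indicator function of `[0, h)`, written with the floor function so that its translates
by multiples of `h` visibly partition the line. -/
noncomputable def blockIndicator (h x : ℝ) : ℝ := if ⌊x / h⌋ = 0 then 1 else 0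

/-- A function bounded by a step function with mesh `h` and absolutely summable heights. -/
def BlockDominated (h : ℝ) (z : ℝ → ℝ) : Prop :=
  ∃ b : ℤ → ℝ, Summable b ∧ ∀ t, |z t| ≤ b ⌊t / h⌋

variable {M : ℕ} {p s : Fin M → ℝ} {z : ℝ → ℝ}

lemma levelSum_zero (t : ℝ) : levelSum p s z 0 t = z t := by
  simp [levelSum]

lemma levelSum_succ (n : ℕ) (t : ℝ) :
    levelSum p s z (n + 1) t = ∑ i, p i * levelSum p s z n (t - s i) := by
  unfold levelSum
  rw [← (Fin.consEquiv (fun _ : Fin (n + 1) => Fin M)).sum_comp, Fintype.sum_prod_type]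
  refine Finset.sum_congr rfl fun i _ => ?_
  rw [Finset.mul_sum]
  refine Finset.sum_congr rfl fun ω _ => ?_
  simp only [Fin.consEquiv_apply, Fin.sum_univ_succ, Fin.prod_univ_succ, Fin.cons_zero,
    Fin.cons_succ]
  rw [sub_sub]; ring

/-- A nonnegative supersolution of the renewal equation dominates the partial sums of the
renewal series. -/
lemma sum_levelSum_le (hp : ∀ i, 0 < p i) {H : ℝ → ℝ} (hH : ∀ t, 0 ≤ H t)
    (hz : ∀ t, z t + ∑ i, p i * H (t - s i) ≤ H t) (N : ℕ) (t : ℝ) :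
    ∑ n ∈ Finset.range N, levelSum p s z n t ≤ H t := by
  induction N generalizing t with
  | zero => simpa using hH t
  | succ N ih =>
    rw [Finset.sum_range_succ', levelSum_zero]
    simp only [levelSum_succ]
    rw [Finset.sum_comm]
    simp only [← Finset.mul_sum]
    have : ∑ i, p i * ∑ n ∈ Finset.range N, levelSum p s z n (t - s i)
        ≤ ∑ i, p i * H (t - s i) :=
      Finset.sum_le_sum fun i _ => mul_le_mul_of_nonneg_left (ih _) (hp i).le
    linarith [hz t]

lemma wordWeight_pos (hp : ∀ i, 0 < p i) (w : (n : ℕ) × (Fin n → Fin M)) :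
    0 < wordWeight p w := Finset.prod_pos fun _ _ => hp _

lemma wordShift_nonneg (hs : ∀ i, 0 < s i) (w : (n : ℕ) × (Fin n → Fin M)) :
    0 ≤ wordShift s w := Finset.sum_nonneg fun _ _ => (hs _).le

lemma renewalFunction_eq_wordSum {t : ℝ}
    (h : Summable fun w => z (t - wordShift s w) * wordWeight p w) :
    renewalFunction p s z t = wordSum p s z t := by
  rw [wordSum, h.tsum_sigma]
  unfold renewalFunction
  congr 1
  ext n
  rw [tsum_fintype]
  rfl

/-- The steps are bounded below by a positive constant. -/
lemma exists_le_step (hs : ∀ i, 0 < s i) : ∃ σ > 0, ∀ i, σ ≤ s i := by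
  rcases isEmpty_or_nonempty (Fin M) with h | h
  · exact ⟨1, one_pos, fun i => h.elim i⟩
  · obtain ⟨i, hi⟩ := Finite.exists_min s
    exact ⟨s i, hs i, hi⟩

lemma exists_step_le (s : Fin M → ℝ) : ∃ S > 0, ∀ i, s i ≤ S := by
  obtain ⟨S, hS⟩ := (Set.finite_range s).bddAbove
  exact ⟨max S 1, by positivity, fun i => (hS ⟨i, rfl⟩).trans (le_max_left _ _)⟩

lemma summable_words_of_nonneg (hp : ∀ i, 0 < p i) (hz : ∀ t, 0 ≤ z t) {C : ℝ} {t : ℝ}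
    (hC : ∀ N, ∑ n ∈ Finset.range N, levelSum p s z n t ≤ C) :
    Summable (fun w => z (t - wordShift s w) * wordWeight p w) ∧ wordSum p s z t ≤ C := by
  have hl : ∀ n, 0 ≤ levelSum p s z n t := fun n =>
    Finset.sum_nonneg fun ω _ => mul_nonneg (hz _) (Finset.prod_nonneg fun _ _ => (hp _).le)
  have h1 : Summable fun n => levelSum p s z n t := summable_of_sum_range_le hl hC
  have h2 : Summable (fun w => z (t - wordShift s w) * wordWeight p w) := by
    rw [summable_sigma_of_nonneg fun w => mul_nonneg (hz _) (wordWeight_pos hp _).le]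
    refine ⟨fun n => (hasSum_fintype _).summable, ?_⟩
    simp only [tsum_fintype]
    exact h1
  refine ⟨h2, ?_⟩
  rw [← renewalFunction_eq_wordSum h2]
  exact h1.tsum_le_of_sum_range_le hC

lemma blockIndicator_nonneg (h x : ℝ) : 0 ≤ blockIndicator h x := by
  unfold blockIndicator; split_ifs <;> norm_num

lemma blockIndicator_of_mem {h x : ℝ} (hh : 0 < h) (h0 : 0 ≤ x) (h1 : x < h) :
    blockIndicator h x = 1 := by
  rw [blockIndicator, if_pos]
  rw [Int.floor_eq_zero_iff]
  exact ⟨by positivity, (div_lt_one hh).2 h1⟩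

lemma blockIndicator_of_notMem {h x : ℝ} (hh : 0 < h) (hx : x < 0 ∨ h ≤ x) :
    blockIndicator h x = 0 := by
  rw [blockIndicator, if_neg]
  rw [Int.floor_eq_zero_iff]
  rintro ⟨h0, h1⟩
  rw [div_lt_one hh] at h1
  have : 0 ≤ x := by
    have := mul_nonneg h0 hh.le
    rwa [div_mul_cancel₀ _ hh.ne'] at this
  rcases hx with hx | hx <;> linarith

lemma blockIndicator_sub {h x : ℝ} (hh : 0 < h) (k : ℤ) :
    blockIndicator h (x - k * h) = if ⌊x / h⌋ = k then 1 else 0 := by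
  unfold blockIndicator
  rw [sub_div, mul_div_cancel_right₀ _ hh.ne', Int.floor_sub_intCast]
  simp only [sub_eq_zero]

/-- The renewal measure of an interval of length `h` is bounded uniformly in its position. The
function `arctan + π / 2` is a bounded supersolution of the renewal equation whose defect is
bounded below on the interval. -/
lemma exists_wordSum_blockIndicator_le (hp : ∀ i, 0 < p i) (hsum : ∑ i, p i = 1)
    (hs : ∀ i, 0 < s i) {h : ℝ} (hh : 0 < h) :
    ∃ C > 0, ∀ t, Summable (fun w => blockIndicator h (t - wordShift s w) * wordWeight p w) ∧
      wordSum p s (blockIndicator h) t ≤ C := by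
  obtain ⟨σ, hσ, hσs⟩ := exists_le_step hs
  have hcont : ContinuousOn (fun t => Real.arctan t - Real.arctan (t - σ)) (Set.Icc 0 h) := by
    fun_prop
  obtain ⟨x, -, hx⟩ := isCompact_Icc.exists_isMinOn (Set.nonempty_Icc.2 hh.le) hcont
  set m := Real.arctan x - Real.arctan (x - σ) with hm
  have hm0 : 0 < m := sub_pos.2 (Real.arctan_strictMono (by linarith))
  have hH0 : ∀ t, 0 ≤ (Real.arctan t + Real.pi / 2) / m := fun t =>
    div_nonneg (by linarith [Real.neg_pi_div_two_lt_arctan t]) hm0.le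
  refine ⟨Real.pi / m, by positivity, fun t => ?_⟩
  refine summable_words_of_nonneg hp (blockIndicator_nonneg h) fun N =>
    (sum_levelSum_le hp hH0 (fun t => ?_) N t).trans ?_
  · have h1 : ∑ i, p i * ((Real.arctan (t - s i) + Real.pi / 2) / m)
        ≤ (Real.arctan (t - σ) + Real.pi / 2) / m := by
      calc _ ≤ ∑ i, p i * ((Real.arctan (t - σ) + Real.pi / 2) / m) := by
            refine Finset.sum_le_sum fun i _ => mul_le_mul_of_nonneg_left ?_ (hp i).le
            gcongr
            exact hσs i
        _ = _ := by rw [← Finset.sum_mul, hsum, one_mul]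
    have h2 : blockIndicator h t ≤ (Real.arctan t - Real.arctan (t - σ)) / m := by
      by_cases ht : 0 ≤ t ∧ t < h
      · rw [blockIndicator_of_mem hh ht.1 ht.2, le_div_iff₀ hm0, one_mul]
        exact hx ⟨ht.1, ht.2.le⟩
      · rw [blockIndicator_of_notMem hh (by by_contra! h'; exact ht h')]
        exact div_nonneg (sub_nonneg.2 (Real.arctan_strictMono.monotone (by linarith))) hm0.le
    calc _ ≤ (Real.arctan t - Real.arctan (t - σ)) / m
          + (Real.arctan (t - σ) + Real.pi / 2) / m := add_le_add h2 h1
      _ = _ := by ring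
  · gcongr
    linarith [Real.arctan_lt_pi_div_two t]

/-! ### Step functions and dominated functions -/

/-- Fubini for step functions: the renewal sum of a step function is the corresponding
combination of renewal measures of blocks. -/
lemma summable_step (hp : ∀ i, 0 < p i) (hsum : ∑ i, p i = 1)
    (hs : ∀ i, 0 < s i) {h : ℝ} (hh : 0 < h) {c : ℤ → ℝ} (hc : Summable c) (t : ℝ) :
    Summable (fun w => c ⌊(t - wordShift s w) / h⌋ * wordWeight p w) ∧
      wordSum p s (fun x => c ⌊x / h⌋) t
        = ∑' k : ℤ, c k * wordSum p s (blockIndicator h) (t - k * h) := by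
  obtain ⟨C, hC0, hC⟩ := exists_wordSum_blockIndicator_le hp hsum hs hh
  have hV0 : ∀ t, 0 ≤ wordSum p s (blockIndicator h) t := fun t =>
    tsum_nonneg fun w => mul_nonneg (blockIndicator_nonneg _ _) (wordWeight_pos hp w).le
  set F : ℤ × ((n : ℕ) × (Fin n → Fin M)) → ℝ := fun q =>
    c q.1 * (blockIndicator h (t - q.1 * h - wordShift s q.2) * wordWeight p q.2) with hF
  have hFs : Summable F := by
    rw [← summable_abs_iff]
    have habs : ∀ q, |F q| = |c q.1| *
        (blockIndicator h (t - q.1 * h - wordShift s q.2) * wordWeight p q.2) := fun q => by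
      simp only [hF]
      rw [abs_mul, abs_of_nonneg (mul_nonneg (blockIndicator_nonneg h (t - q.1 * h - _))
        (wordWeight_pos hp q.2).le)]
    simp only [habs]
    rw [summable_prod_of_nonneg fun q => mul_nonneg (abs_nonneg _)
      (mul_nonneg (blockIndicator_nonneg _ _) (wordWeight_pos hp _).le)]
    have hVs : Summable fun k : ℤ => |c k| * wordSum p s (blockIndicator h) (t - k * h) :=
      Summable.of_nonneg_of_le (fun k => mul_nonneg (abs_nonneg _) (hV0 (t - k * h)))
        (fun k => mul_le_mul_of_nonneg_left (hC (t - k * h)).2 (abs_nonneg _))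
        (hc.abs.mul_right C)
    refine ⟨fun k => (hC (t - k * h)).1.mul_left |c k|, hVs.congr fun k => ?_⟩
    exact tsum_mul_left.symm
  have hfib : ∀ w, ∑' k, F (k, w) = c ⌊(t - wordShift s w) / h⌋ * wordWeight p w := fun w => by
    rw [tsum_eq_single ⌊(t - wordShift s w) / h⌋]
    · simp only [hF]
      rw [sub_right_comm, blockIndicator_sub hh, if_pos rfl, one_mul]
    · intro k hk
      simp only [hF]
      rw [sub_right_comm, blockIndicator_sub hh, if_neg (Ne.symm hk), zero_mul, mul_zero]
  refine ⟨?_, ?_⟩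
  · have := hFs.prod_symm.prod
    refine this.congr fun w => ?_
    rw [← hfib w]; rfl
  · unfold wordSum
    calc _ = ∑' w, ∑' k, F (k, w) := by simp only [hfib]
      _ = ∑' k, ∑' w, F (k, w) := hFs.tsum_comm
      _ = _ := by simp only [hF, tsum_mul_left]

lemma wordSum_blockIndicator_nonneg (hp : ∀ i, 0 < p i) (h t : ℝ) :
    0 ≤ wordSum p s (blockIndicator h) t :=
  tsum_nonneg fun w => mul_nonneg (blockIndicator_nonneg _ _) (wordWeight_pos hp w).le

lemma wordSum_blockIndicator_of_neg (hs : ∀ i, 0 < s i) {h t : ℝ} (hh : 0 < h) (ht : t < 0) :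
    wordSum p s (blockIndicator h) t = 0 := by
  unfold wordSum
  rw [tsum_congr fun w => ?_, tsum_zero]
  rw [blockIndicator_of_notMem hh (.inl (by linarith [wordShift_nonneg hs w])), zero_mul]

lemma BlockDominated.summable_abs (hp : ∀ i, 0 < p i) (hsum : ∑ i, p i = 1)
    (hs : ∀ i, 0 < s i) {h : ℝ} (hh : 0 < h) (hz : BlockDominated h z) (t : ℝ) :
    Summable (fun w => |z (t - wordShift s w)| * wordWeight p w) := by
  obtain ⟨b, hb, hzb⟩ := hz
  exact Summable.of_nonneg_of_le (fun w => mul_nonneg (abs_nonneg _) (wordWeight_pos hp w).le)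
    (fun w => mul_le_mul_of_nonneg_right (hzb _) (wordWeight_pos hp w).le)
    (summable_step hp hsum hs hh hb t).1

lemma BlockDominated.summable (hp : ∀ i, 0 < p i) (hsum : ∑ i, p i = 1)
    (hs : ∀ i, 0 < s i) {h : ℝ} (hh : 0 < h) (hz : BlockDominated h z) (t : ℝ) :
    Summable (fun w => z (t - wordShift s w) * wordWeight p w) := by
  rw [← summable_abs_iff]
  refine (hz.summable_abs hp hsum hs hh t).congr fun w => ?_
  rw [abs_mul, abs_of_pos (wordWeight_pos hp w)]

lemma BlockDominated.abs_wordSum_le (hp : ∀ i, 0 < p i) (hsum : ∑ i, p i = 1)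
    (hs : ∀ i, 0 < s i) {h : ℝ} (hh : 0 < h) {b : ℤ → ℝ} (hb : Summable b)
    (hz : ∀ t, |z t| ≤ b ⌊t / h⌋) (t : ℝ) :
    |wordSum p s z t| ≤ ∑' k : ℤ, b k * wordSum p s (blockIndicator h) (t - k * h) := by
  have h1 := summable_step hp hsum hs hh hb t
  rw [← h1.2, ← Real.norm_eq_abs]
  refine tsum_of_norm_bounded h1.1.hasSum fun w => ?_
  rw [norm_mul, Real.norm_eq_abs, Real.norm_eq_abs, abs_of_pos (wordWeight_pos hp w)]
  exact mul_le_mul_of_nonneg_right (hz _) (wordWeight_pos hp w).le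

lemma nonneg_of_blockBound {h : ℝ} (hh : 0 < h) {b : ℤ → ℝ} (hz : ∀ t, |z t| ≤ b ⌊t / h⌋)
    (k : ℤ) : 0 ≤ b k := by
  have := (abs_nonneg _).trans (hz (k * h))
  rwa [mul_div_cancel_right₀ _ hh.ne', Int.floor_intCast] at this

lemma BlockDominated.bounded (hp : ∀ i, 0 < p i) (hsum : ∑ i, p i = 1)
    (hs : ∀ i, 0 < s i) {h : ℝ} (hh : 0 < h) (hz : BlockDominated h z) :
    ∃ C > 0, ∀ t, |wordSum p s z t| ≤ C := by
  obtain ⟨b, hb, hzb⟩ := hz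
  obtain ⟨C, hC0, hC⟩ := exists_wordSum_blockIndicator_le hp hsum hs hh
  have hb0 := nonneg_of_blockBound hh hzb
  refine ⟨∑' k, b k * C + 1, by
    have : 0 ≤ ∑' k, b k * C := tsum_nonneg fun k => mul_nonneg (hb0 k) hC0.le
    linarith, fun t => ?_⟩
  have hle : ∀ k : ℤ, b k * wordSum p s (blockIndicator h) (t - k * h) ≤ b k * C := fun k =>
    mul_le_mul_of_nonneg_left (hC _).2 (hb0 k)
  have := Summable.tsum_le_tsum hle (Summable.of_nonneg_of_le
    (fun k => mul_nonneg (hb0 k) (wordSum_blockIndicator_nonneg hp _ _)) hle (hb.mul_right C))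
    (hb.mul_right C)
  linarith [BlockDominated.abs_wordSum_le hp hsum hs hh hb hzb t]

lemma BlockDominated.tendsto_atBot (hp : ∀ i, 0 < p i) (hsum : ∑ i, p i = 1)
    (hs : ∀ i, 0 < s i) {h : ℝ} (hh : 0 < h) (hz : BlockDominated h z) :
    Tendsto (wordSum p s z) atBot (𝓝 0) := by
  obtain ⟨b, hb, hzb⟩ := hz
  obtain ⟨C, hC0, hC⟩ := exists_wordSum_blockIndicator_le hp hsum hs hh
  have hb0 := nonneg_of_blockBound hh hzb
  refine squeeze_zero_norm (fun t => BlockDominated.abs_wordSum_le hp hsum hs hh hb hzb t) ?_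
  have := tendsto_tsum_of_dominated_convergence (𝓕 := atBot)
    (f := fun (t : ℝ) (k : ℤ) => b k * wordSum p s (blockIndicator h) (t - k * h))
    (g := fun _ => 0) (hb.mul_right C) (fun k => ?_) (Eventually.of_forall fun t k => ?_)
  · simpa using this
  · refine tendsto_const_nhds.congr' ?_
    filter_upwards [eventually_lt_atBot (k * h)] with t ht
    rw [wordSum_blockIndicator_of_neg hs hh (by linarith), mul_zero]
  · rw [Real.norm_eq_abs, abs_of_nonneg (mul_nonneg (hb0 k) (wordSum_blockIndicator_nonneg hp _ _))]
    exact mul_le_mul_of_nonneg_left (hC _).2 (hb0 k)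

/-- Splitting off the first letter of a word gives the renewal equation. -/
lemma BlockDominated.renewal_equation (hp : ∀ i, 0 < p i) (hsum : ∑ i, p i = 1)
    (hs : ∀ i, 0 < s i) {h : ℝ} (hh : 0 < h) (hz : BlockDominated h z) (t : ℝ) :
    wordSum p s z t = ∑ i, p i * wordSum p s z (t - s i) + z t := by
  have hsm := hz.summable hp hsum hs hh
  have hl : ∀ t, Summable fun n => levelSum p s z n t := fun t => by
    have := (hsm t).sigma
    simp only [tsum_fintype] at this
    exact this
  simp only [← renewalFunction_eq_wordSum (hsm _)]
  unfold renewalFunction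
  rw [(hl t).tsum_eq_zero_add, levelSum_zero, add_comm]
  congr 1
  simp only [levelSum_succ]
  rw [Summable.tsum_finsetSum fun i _ => (hl _).mul_left _]
  simp only [tsum_mul_left]

lemma wordSum_mono (hp : ∀ i, 0 < p i) {z₁ z₂ : ℝ → ℝ} (hle : ∀ t, z₁ t ≤ z₂ t) {t : ℝ}
    (h₁ : Summable (fun w => z₁ (t - wordShift s w) * wordWeight p w))
    (h₂ : Summable (fun w => z₂ (t - wordShift s w) * wordWeight p w)) :
    wordSum p s z₁ t ≤ wordSum p s z₂ t :=
  h₁.tsum_le_tsum (fun w => mul_le_mul_of_nonneg_right (hle _) (wordWeight_pos hp w).le) h₂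

/-- Bounded functions supported in `[-A, A]` are dominated at every mesh. -/
lemma BlockDominated.of_support {h : ℝ} (hh : 0 < h) {A C : ℝ} (hC : ∀ t, |z t| ≤ C)
    (hA : ∀ t, A < |t| → z t = 0) : BlockDominated h z := by
  refine ⟨fun k => if k ∈ Set.Icc ⌊-A / h⌋ ⌊A / h⌋ then C else 0, ?_, fun t => ?_⟩
  · refine summable_of_hasFiniteSupport ((Set.finite_Icc ⌊-A / h⌋ ⌊A / h⌋).subset fun k hk => ?_)
    by_contra h'
    exact hk (if_neg h')
  · dsimp only
    split_ifs with h'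
    · exact hC t
    · rw [hA t, abs_zero]
      by_contra! ht
      rw [abs_le] at ht
      exact h' ⟨Int.floor_mono (by gcongr; exact ht.1), Int.floor_mono (by gcongr; exact ht.2)⟩

/-! ### The semigroup generated by the steps -/

lemma exists_wordShift_eq {x : ℝ} (hx : x ∈ AddSubmonoid.closure (Set.range s)) :
    ∃ w, wordShift s w = x := by
  induction hx using AddSubmonoid.closure_induction with
  | mem x hx =>
    obtain ⟨i, rfl⟩ := hx
    exact ⟨⟨1, fun _ => i⟩, by simp [wordShift]⟩
  | zero => exact ⟨⟨0, Fin.elim0⟩, by simp [wordShift]⟩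
  | add x y _ _ hx hy =>
    obtain ⟨⟨m, v⟩, rfl⟩ := hx
    obtain ⟨⟨n, w⟩, rfl⟩ := hy
    exact ⟨⟨m + n, Fin.append v w⟩, by simp [wordShift, Fin.sum_univ_add]⟩

lemma exists_sub_eq_of_mem_closure {g : ℝ} (hg : g ∈ AddSubgroup.closure (Set.range s)) :
    ∃ x ∈ AddSubmonoid.closure (Set.range s), ∃ y ∈ AddSubmonoid.closure (Set.range s),
      g = x - y := by
  induction hg using AddSubgroup.closure_induction with
  | mem x hx => exact ⟨x, AddSubmonoid.subset_closure hx, 0, zero_mem _, by simp⟩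
  | zero => exact ⟨0, zero_mem _, 0, zero_mem _, by simp⟩
  | add a b _ _ ha hb =>
    obtain ⟨x, hx, y, hy, rfl⟩ := ha
    obtain ⟨x', hx', y', hy', rfl⟩ := hb
    exact ⟨x + x', add_mem hx hx', y + y', add_mem hy hy', by ring⟩
  | neg a _ ha =>
    obtain ⟨x, hx, y, hy, rfl⟩ := ha
    exact ⟨y, hy, x, hx, by ring⟩

/-- An additive submonoid of `ℝ` containing `y > 0` and `y + g` with `g > 0` eventually has gaps of
length at most `g`: it contains the progressions `K y + m y + k g` for `k ≤ K`, and these overlap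
once `K g ≥ y`. -/
lemma exists_mem_Ioc_of_sub_eq {N : AddSubmonoid ℝ} {x y g : ℝ} (hx : x ∈ N) (hy : y ∈ N)
    (hy0 : 0 < y) (hg : 0 < g) (hxy : g = x - y) :
    ∃ R, ∀ u ≥ R, ∃ v ∈ N, u - g < v ∧ v ≤ u := by
  obtain ⟨K, hK⟩ := exists_nat_ge (y / g)
  refine ⟨K * y, fun u hu => ?_⟩
  set m := ⌊(u - K * y) / y⌋₊ with hm
  have h0 : 0 ≤ (u - K * y) / y := div_nonneg (by linarith) hy0.le
  have hm1 : m * y ≤ u - K * y := by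
    rw [← le_div_iff₀ hy0]; exact Nat.floor_le h0
  have hm2 : u - K * y < (m + 1) * y := by
    rw [← div_lt_iff₀ hy0]; exact Nat.lt_floor_add_one _
  set r := u - K * y - m * y with hr
  have hr0 : 0 ≤ r / g := div_nonneg (by linarith) hg.le
  set k := ⌊r / g⌋₊ with hk
  have hk1 : k * g ≤ r := by
    rw [← le_div_iff₀ hg]; exact Nat.floor_le hr0
  have hk2 : r < (k + 1) * g := by
    rw [← div_lt_iff₀ hg]; exact Nat.lt_floor_add_one _
  have hkK : k ≤ K := by
    have : r / g ≤ y / g := by gcongr; linarith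
    exact_mod_cast (Nat.floor_le hr0).trans (this.trans hK)
  obtain ⟨d, hd⟩ := Nat.exists_eq_add_of_le hkK
  refine ⟨k • x + (d + m) • y, add_mem (N.nsmul_mem hx _) (N.nsmul_mem hy _), ?_, ?_⟩
  all_goals
    have hxe : x = y + g := by linarith
    have hKe : (K : ℝ) = k + d := by exact_mod_cast hd
    simp only [nsmul_eq_mul, Nat.cast_add]
    rw [hxe]
    rw [hKe] at hr
    nlinarith

/-- Every positive element `g` of the group generated by the steps bounds the gaps of the
set of word shifts far out. -/
lemma exists_wordShift_mem_Ioc (hM : 0 < M) (hs : ∀ i, 0 < s i) {g : ℝ}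
    (hg : g ∈ AddSubgroup.closure (Set.range s)) (hg0 : 0 < g) :
    ∃ R, ∀ u ≥ R, ∃ w, u - g < wordShift s w ∧ wordShift s w ≤ u := by
  obtain ⟨x, hx, y, hy, hxy⟩ := exists_sub_eq_of_mem_closure hg
  have h0 : s ⟨0, hM⟩ ∈ AddSubmonoid.closure (Set.range s) :=
    AddSubmonoid.subset_closure ⟨_, rfl⟩
  have hy0 : 0 ≤ y := by
    obtain ⟨w, rfl⟩ := exists_wordShift_eq hy
    exact wordShift_nonneg hs w
  obtain ⟨R, hR⟩ := exists_mem_Ioc_of_sub_eq (add_mem hx h0) (add_mem hy h0)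
    (by linarith [hs ⟨0, hM⟩]) hg0 (by rw [hxy]; ring)
  refine ⟨R, fun u hu => ?_⟩
  obtain ⟨v, hv, h⟩ := hR u hu
  obtain ⟨w, rfl⟩ := exists_wordShift_eq hv
  exact ⟨w, h⟩

/-! ### Convergence of bounded solutions of the homogeneous equation -/

/-- Maximum principle: a subsolution of the homogeneous renewal equation on `[T, ∞)` is bounded by
its supremum on a window of length `S ≥ max s_i` before `T`. -/
lemma le_of_forall_window_le (hp : ∀ i, 0 < p i) (hsum : ∑ i, p i = 1) (hs : ∀ i, 0 < s i)
    {S T K : ℝ} (hS : ∀ i, s i ≤ S) {g : ℝ → ℝ}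
    (hg : ∀ x ≥ T, g x ≤ ∑ i, p i * g (x - s i))
    (hK : ∀ x, T - S ≤ x → x ≤ T → g x ≤ K) {x : ℝ} (hx : T - S ≤ x) : g x ≤ K := by
  obtain ⟨σ, hσ, hσs⟩ := exists_le_step hs
  have key : ∀ n : ℕ, ∀ x, T - S ≤ x → x ≤ T + n * σ → g x ≤ K := by
    intro n
    induction n with
    | zero => intro x h1 h2; exact hK x h1 (by simpa using h2)
    | succ n ih =>
      intro x h1 h2
      rcases le_total x T with h | h
      · exact hK x h1 h
      · calc g x ≤ ∑ i, p i * g (x - s i) := hg x h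
          _ ≤ ∑ i, p i * K := by
              refine Finset.sum_le_sum fun i _ => mul_le_mul_of_nonneg_left ?_ (hp i).le
              refine ih _ (by linarith [hS i]) ?_
              push_cast at h2
              linarith [hσs i]
          _ = K := by rw [← Finset.sum_mul, hsum, one_mul]
  obtain ⟨n, hn⟩ := exists_nat_ge ((x - T) / σ)
  rw [div_le_iff₀ hσ] at hn
  exact key n x hx (by linarith)

/-- If a weighted average of values at most `m` is close to `m`, then so is each value. Iterating
along a word costs a factor depending only on the length of the word. -/
lemma exists_le_of_word (hp : ∀ i, 0 < p i) (hsum : ∑ i, p i = 1) (hs : ∀ i, 0 < s i)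
    (n : ℕ) : ∃ K > 0, ∀ (Z : ℝ → ℝ) (T S c η t : ℝ), (∀ i, s i ≤ S) → 0 < η →
      (∀ x ≥ T, Z x = ∑ i, p i * Z (x - s i)) → (∀ x ≥ T - S, Z x ≤ c + η) → c - η ≤ Z t →
      ∀ ω : Fin n → Fin M, T ≤ t - ∑ j, s (ω j) → c - K * η ≤ Z (t - ∑ j, s (ω j)) := by
  obtain ⟨q, hq, hqp⟩ := exists_le_step hp
  induction n with
  | zero => exact ⟨1, one_pos, fun Z T S c η t _ _ _ _ ht ω _ => by simpa using ht⟩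
  | succ n ih =>
    obtain ⟨K, hK0, hK⟩ := ih
    refine ⟨(K + 1) / q, by positivity, fun Z T S c η t hS hη heq hle ht ω hω => ?_⟩
    rw [Fin.sum_univ_castSucc] at hω ⊢
    set i := ω (Fin.last n)
    have hx : T ≤ t - ∑ j : Fin n, s (ω j.castSucc) := by linarith [hs i]
    have h1 := hK Z T S c η t hS hη heq hle ht (fun j => ω j.castSucc) hx
    rw [← sub_sub]
    set x := t - ∑ j : Fin n, s (ω j.castSucc)
    have h2 : ∑ j, p j * (c + η - Z (x - s j)) = c + η - Z x := by
      simp only [mul_sub, Finset.sum_sub_distrib]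
      rw [← Finset.sum_mul, hsum, one_mul, ← heq x hx]
    have h3 : p i * (c + η - Z (x - s i)) ≤ c + η - Z x := by
      rw [← h2]
      exact Finset.single_le_sum (f := fun j => p j * (c + η - Z (x - s j)))
        (fun j _ => mul_nonneg (hp j).le (by
          linarith [hle (x - s j) (by linarith [hS j])])) (Finset.mem_univ i)
    have h4 : 0 ≤ c + η - Z (x - s i) := by linarith [hle (x - s i) (by linarith [hS i])]
    have h5 : q * (c + η - Z (x - s i)) ≤ (K + 1) * η := by
      nlinarith [mul_le_mul_of_nonneg_right (hqp i) h4]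
    have h6 : c + η - Z (x - s i) ≤ (K + 1) / q * η := by
      rw [div_mul_eq_mul_div, le_div_iff₀ hq]; linarith
    linarith

/-- A bounded function that eventually solves the homogeneous renewal equation converges, provided
that on a suitable window each of its values is close to a value reached by a word of bounded
shift. If the solution is close to its limit superior at `t`, it is so along all short words
from `t`, hence on a whole window, hence on all later times by the maximum principle. -/
lemma exists_tendsto_of_homogeneous (hp : ∀ i, 0 < p i) (hsum : ∑ i, p i = 1)
    (hs : ∀ i, 0 < s i) {Z : ℝ → ℝ} {C T₀ S : ℝ} (hC : ∀ t, |Z t| ≤ C) (hS : ∀ i, s i ≤ S)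
    (heq : ∀ t ≥ T₀, Z t = ∑ i, p i * Z (t - s i))
    (hD : ∀ ε > 0, ∃ R B, ∀ t u, R ≤ u → u ≤ R + S →
      ∃ w, wordShift s w ≤ B ∧ |Z (t - u) - Z (t - wordShift s w)| ≤ ε) :
    ∃ c, Tendsto Z atTop (𝓝 c) := by
  have hb1 : IsBoundedUnder (· ≤ ·) atTop Z :=
    isBoundedUnder_of ⟨C, fun t => (abs_le.1 (hC t)).2⟩
  have hb2 : IsBoundedUnder (· ≥ ·) atTop Z :=
    isBoundedUnder_of ⟨-C, fun t => (abs_le.1 (hC t)).1⟩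
  set c := limsup Z atTop with hc
  refine ⟨c, Metric.tendsto_nhds.2 fun ε hε => ?_⟩
  obtain ⟨R, B, hRB⟩ := hD (ε / 3) (by positivity)
  obtain ⟨σ, hσ, hσs⟩ := exists_le_step hs
  obtain ⟨N, hN⟩ := exists_nat_ge (B / σ)
  choose K hK0 hK using exists_le_of_word hp hsum hs
  -- one constant for all words of length at most `N`
  set Kmax := ∑ n ∈ Finset.range (N + 1), K n with hKmax
  have hKpos : 0 < Kmax := Finset.sum_pos (fun n _ => hK0 n) ⟨0, by simp⟩
  set η := ε / (3 * Kmax) with hη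
  have hη0 : 0 < η := by positivity
  obtain ⟨T₁, hT₁⟩ := eventually_atTop.1 (eventually_lt_of_limsup_lt
    (show limsup Z atTop < c + η by linarith) hb1)
  have hfreq := frequently_lt_of_lt_limsup hb2.isCoboundedUnder_le
    (show c - η < limsup Z atTop by linarith)
  set T := max T₀ (T₁ + S) with hT
  obtain ⟨t, ht, htZ⟩ := frequently_atTop.1 hfreq (max (T + B) (T + R))
  have htB := (le_max_left _ _).trans ht
  have htR := (le_max_right _ _).trans ht
  have hTeq : ∀ x ≥ T, Z x = ∑ i, p i * Z (x - s i) := fun x hx =>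
    heq x ((le_max_left _ _).trans hx)
  have hwin : ∀ u, R ≤ u → u ≤ R + S → c - 2 * ε / 3 ≤ Z (t - u) := by
    intro u hu1 hu2
    obtain ⟨w, hwB, hw⟩ := hRB t u hu1 hu2
    have hlen : w.1 ≤ N := by
      have h1 : w.1 * σ ≤ wordShift s w := by
        have := Finset.card_nsmul_le_sum Finset.univ (fun j => s (w.2 j)) σ fun j _ => hσs _
        simpa [wordShift] using this
      have h2 : (w.1 : ℝ) ≤ B / σ := by rw [le_div_iff₀ hσ]; linarith
      exact_mod_cast h2.trans hN
    have h1 := hK w.1 Z T S c η t hS hη0 hTeq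
      (fun x hx => (hT₁ x (by linarith [le_max_right T₀ (T₁ + S)])).le) htZ.le w.2
      (show T ≤ t - wordShift s w by linarith)
    change c - K w.1 * η ≤ Z (t - wordShift s w) at h1
    have h2 : K w.1 ≤ Kmax := Finset.single_le_sum (f := K) (fun n _ => (hK0 n).le)
      (Finset.mem_range.2 (by omega))
    have h3 : K w.1 * η ≤ ε / 3 := by
      calc K w.1 * η ≤ Kmax * η := mul_le_mul_of_nonneg_right h2 hη0.le
        _ = ε / 3 := by rw [hη]; field_simp
    linarith [(abs_le.1 hw).1]
  have hlow : ∀ x ≥ t - R - S, -Z x ≤ -(c - 2 * ε / 3) := fun x hx =>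
    le_of_forall_window_le hp hsum hs hS (T := t - R) (g := fun x => -Z x)
      (fun x hx => by
        rw [hTeq x (by linarith)]
        simp) (fun x h1 h2 => by
        have := hwin (t - x) (by linarith) (by linarith)
        rw [sub_sub_cancel] at this
        linarith) hx
  filter_upwards [eventually_ge_atTop (t - R - S), eventually_lt_of_limsup_lt
    (show limsup Z atTop < c + ε by linarith) hb1] with x hx1 hx2
  rw [Real.dist_eq, abs_lt]
  constructor <;> linarith [hlow x hx1]

/-! ### Integration of step functions and of renewal sums -/

lemma setOf_floor_div_eq {h : ℝ} (hh : 0 < h) (k : ℤ) :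
    {x : ℝ | ⌊x / h⌋ = k} = Set.Ico (k * h) ((k + 1) * h) := by
  ext x
  rw [Set.mem_ofPred_eq, Int.floor_eq_iff, le_div_iff₀ hh, div_lt_iff₀ hh, Set.mem_Ico]

lemma integral_step {h : ℝ} (hh : 0 < h) {c : ℤ → ℝ} (hc : Summable c) :
    Integrable (fun x => c ⌊x / h⌋) ∧ ∫ x, c ⌊x / h⌋ = ∑' k, h * c k := by
  set B : ℤ → Set ℝ := fun k => {x : ℝ | ⌊x / h⌋ = k} with hB
  have hBm : ∀ k, MeasurableSet (B k) := fun k => by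
    rw [hB]; dsimp only; rw [setOf_floor_div_eq hh]; exact measurableSet_Ico
  have hBv : ∀ k, volume (B k) = ENNReal.ofReal h := fun k => by
    rw [hB]; dsimp only; rw [setOf_floor_div_eq hh, Real.volume_Ico]; congr 1; ring
  have hBr : ∀ k, volume.real (B k) = h := fun k => by
    rw [Measure.real, hBv, ENNReal.toReal_ofReal hh.le]
  have hU : ⋃ k, B k = Set.univ := Set.eq_univ_of_forall fun x => Set.mem_iUnion.2 ⟨_, rfl⟩
  have hd : Pairwise (Function.onFun Disjoint B) := fun i j hij =>
    Set.disjoint_left.2 fun x hi hj => hij (hi.symm.trans hj)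
  have hi : ∀ k, IntegrableOn (fun x => c ⌊x / h⌋) (B k) := fun k => by
    refine (integrableOn_congr_fun (f := fun _ => c k) (fun x hx => ?_) (hBm k)).1
      (integrableOn_const (by rw [hBv]; exact ENNReal.ofReal_ne_top))
    rw [show ⌊x / h⌋ = k from hx]
  have hn : ∀ k, ∫ x in B k, ‖c ⌊x / h⌋‖ = h * |c k| := fun k => by
    rw [setIntegral_congr_fun (g := fun _ => |c k|) (hBm k) fun x hx => by
      rw [show ⌊x / h⌋ = k from hx, Real.norm_eq_abs], setIntegral_const, hBr, smul_eq_mul]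
  have hv : ∀ k, ∫ x in B k, c ⌊x / h⌋ = h * c k := fun k => by
    rw [setIntegral_congr_fun (g := fun _ => c k) (hBm k) fun x hx => by
      rw [show ⌊x / h⌋ = k from hx], setIntegral_const, hBr, smul_eq_mul]
  have hint : IntegrableOn (fun x => c ⌊x / h⌋) (⋃ k, B k) :=
    integrableOn_iUnion_of_summable_integral_norm hi (by simp only [hn]; exact hc.abs.mul_left h)
  refine ⟨by rwa [hU, integrableOn_univ] at hint, ?_⟩
  rw [← setIntegral_univ, ← hU, integral_iUnion hBm hd hint]
  simp only [hv]

lemma BlockDominated.integrable {h : ℝ} (hh : 0 < h) (hz : BlockDominated h z)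
    (hm : AEStronglyMeasurable z volume) : Integrable z := by
  obtain ⟨b, hb, hzb⟩ := hz
  exact (integral_step hh hb).1.mono' hm (Eventually.of_forall hzb)

lemma aestronglyMeasurable_wordSum (hm : AEStronglyMeasurable z volume)
    (hsm : ∀ t, Summable (fun w => z (t - wordShift s w) * wordWeight p w)) :
    AEStronglyMeasurable (wordSum p s z) volume := by
  refine aestronglyMeasurable_of_tendsto_ae (u := atTop)
    (f := fun (F : Finset ((n : ℕ) × (Fin n → Fin M))) t =>
      ∑ w ∈ F, z (t - wordShift s w) * wordWeight p w) (fun F => ?_)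
    (Eventually.of_forall fun t => (hsm t).hasSum)
  refine Finset.aestronglyMeasurable_fun_sum F fun w _ => ?_
  exact (hm.comp_measurePreserving (measurePreserving_sub_right volume _)).mul_const _

lemma BlockDominated.intervalIntegrable (hp : ∀ i, 0 < p i) (hsum : ∑ i, p i = 1)
    (hs : ∀ i, 0 < s i) {h : ℝ} (hh : 0 < h) (hz : BlockDominated h z)
    (hm : AEStronglyMeasurable z volume) (a b : ℝ) :
    IntervalIntegrable (wordSum p s z) volume a b := by
  obtain ⟨C, -, hC⟩ := hz.bounded hp hsum hs hh
  have hZ := aestronglyMeasurable_wordSum hm (hz.summable hp hsum hs hh)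
  refine (intervalIntegrable_const (c := C)).mono_fun hZ.restrict (Eventually.of_forall fun t => ?_)
  exact (hC t).trans (le_abs_self C)

/-! ### Averages of renewal sums -/

lemma mean_pos (hM : 0 < M) (hp : ∀ i, 0 < p i) (hs : ∀ i, 0 < s i) : 0 < mean p s :=
  Finset.sum_pos (fun i _ => mul_pos (hp i) (hs i)) ⟨⟨0, hM⟩, Finset.mem_univ _⟩

/-- If the increments `A x - A (x - s i)` average out to at most `I` in the limit, then `A` grows
with slope at most `I / mean`: subtracting a slightly steeper linear function leaves a
subsolution of the homogeneous equation, which is bounded by the maximum principle. -/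
lemma eventually_le_of_increments (hM : 0 < M) (hp : ∀ i, 0 < p i) (hsum : ∑ i, p i = 1)
    (hs : ∀ i, 0 < s i) {A : ℝ → ℝ} (hA : Continuous A) {I : ℝ}
    (hI : Tendsto (fun x => ∑ i, p i * (A x - A (x - s i))) atTop (𝓝 I)) {ε : ℝ} (hε : 0 < ε) :
    ∀ᶠ x in atTop, A x ≤ (1 / mean p s * I + ε) * x := by
  have hμ := mean_pos hM hp hs
  obtain ⟨S, hS0, hS⟩ := exists_step_le s
  set c := 1 / mean p s * I + ε / 2 with hc
  have hcμ : c * mean p s = I + ε / 2 * mean p s := by rw [hc]; field_simp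
  obtain ⟨T, hT⟩ := eventually_atTop.1
    (hI.eventually_lt_const (show I < c * mean p s by rw [hcμ]; linarith [mul_pos hε hμ]))
  obtain ⟨K, hK⟩ := (isCompact_Icc (a := T - S) (b := T)).bddAbove_image
    (f := fun x => A x - c * x) (by fun_prop)
  have hsub : ∀ x ≥ T, A x - c * x ≤ ∑ i, p i * (A (x - s i) - c * (x - s i)) := fun x hx => by
    have h1 : ∑ i, p i * (A (x - s i) - c * (x - s i))
        = A x - c * x - ∑ i, p i * (A x - A (x - s i)) + c * mean p s := by
      have h2 : A x - c * x = ∑ i, p i * (A x - c * x) := by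
        rw [← Finset.sum_mul, hsum, one_mul]
      rw [h2, mean, Finset.mul_sum, ← Finset.sum_sub_distrib, ← Finset.sum_add_distrib]
      exact Finset.sum_congr rfl fun i _ => by ring
    linarith [hT x hx]
  have hle : ∀ x ≥ T - S, A x - c * x ≤ K := fun x hx =>
    le_of_forall_window_le hp hsum hs hS hsub (fun y h1 h2 => hK ⟨y, ⟨h1, h2⟩, rfl⟩) hx
  filter_upwards [eventually_ge_atTop (T - S), eventually_ge_atTop (K / (ε / 2))] with x h1 h2
  rw [div_le_iff₀ (by positivity)] at h2
  have := hle x h1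
  calc A x ≤ c * x + x * (ε / 2) := by linarith
    _ = _ := by rw [hc]; ring

lemma tendsto_div_of_increments (hM : 0 < M) (hp : ∀ i, 0 < p i) (hsum : ∑ i, p i = 1)
    (hs : ∀ i, 0 < s i) {A : ℝ → ℝ} (hA : Continuous A) {I : ℝ}
    (hI : Tendsto (fun x => ∑ i, p i * (A x - A (x - s i))) atTop (𝓝 I)) :
    Tendsto (fun x => x⁻¹ * A x) atTop (𝓝 (1 / mean p s * I)) := by
  have hI' : Tendsto (fun x => ∑ i, p i * (-A x - -A (x - s i))) atTop (𝓝 (-I)) := by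
    refine hI.neg.congr fun x => ?_
    rw [← Finset.sum_neg_distrib]
    exact Finset.sum_congr rfl fun i _ => by ring
  refine Metric.tendsto_nhds.2 fun ε hε => ?_
  filter_upwards [eventually_le_of_increments hM hp hsum hs hA hI (half_pos hε),
    eventually_le_of_increments hM hp hsum hs hA.neg hI' (half_pos hε),
    eventually_gt_atTop 0] with x h1 h2 hx
  have e1 : x⁻¹ * A x ≤ 1 / mean p s * I + ε / 2 := by
    rw [inv_mul_le_iff₀ hx]; linarith
  have e2 : 1 / mean p s * I - ε / 2 ≤ x⁻¹ * A x := by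
    rw [Pi.neg_apply] at h2
    rw [le_inv_mul_iff₀ hx]; linarith
  rw [Real.dist_eq, abs_lt]
  constructor <;> linarith

/-- Integrating the renewal equation over `(-∞, x]` expresses the averaged integral of the renewal
sum over the windows `[x - s i, x]` through `∫ z`. The constant of integration is found by letting
`x → -∞`, where the renewal sum vanishes. -/
lemma BlockDominated.tendsto_increments (hp : ∀ i, 0 < p i) (hsum : ∑ i, p i = 1)
    (hs : ∀ i, 0 < s i) {h : ℝ} (hh : 0 < h) (hz : BlockDominated h z)
    (hm : AEStronglyMeasurable z volume) :
    Tendsto (fun x => ∑ i, p i * ((∫ y in (0 : ℝ)..x, wordSum p s z y)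
      - ∫ y in (0 : ℝ)..(x - s i), wordSum p s z y)) atTop (𝓝 (∫ y, z y)) := by
  set Z := wordSum p s z with hZ
  have hII := hz.intervalIntegrable hp hsum hs hh hm
  have hzi := hz.integrable hh hm
  set E : ℝ → ℝ := fun x => ∑ i, p i * ((∫ y in (0 : ℝ)..x, Z y)
      - ∫ y in (0 : ℝ)..(x - s i), Z y) with hE
  have hconst : ∀ x, E x = (∫ y in (0 : ℝ)..x, z y) + E 0 := fun x => by
    have h1 : ∀ y, z y = ∑ i, p i * (Z y - Z (y - s i)) := fun y => by
      have := hz.renewal_equation hp hsum hs hh y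
      simp only [mul_sub, Finset.sum_sub_distrib]
      rw [← Finset.sum_mul, hsum, one_mul]
      linarith
    have h2 : ∀ i, ∫ y in (0 : ℝ)..x, p i * (Z y - Z (y - s i)) = p i *
        ((∫ y in (0 : ℝ)..x, Z y) - ((∫ y in (0 : ℝ)..(x - s i), Z y)
          - ∫ y in (0 : ℝ)..(0 - s i), Z y)) := fun i => by
      rw [intervalIntegral.integral_const_mul, intervalIntegral.integral_sub (hII _ _)
        (by simpa using (hII (0 - s i) (x - s i)).comp_sub_right (s i)),
        intervalIntegral.integral_comp_sub_right (fun y => Z y),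
        intervalIntegral.integral_interval_sub_left (hII _ _) (hII _ _)]
    have h3 : ∫ y in (0 : ℝ)..x, z y = ∑ i, ∫ y in (0 : ℝ)..x, p i * (Z y - Z (y - s i)) := by
      rw [← intervalIntegral.integral_finsetSum fun i _ => ?_]
      · simp only [← h1]
      · exact ((hII _ _).sub (by simpa using
          (hII (0 - s i) (x - s i)).comp_sub_right (s i))).const_mul _
    rw [h3, hE]
    dsimp only
    rw [← Finset.sum_add_distrib]
    refine Finset.sum_congr rfl fun i _ => ?_
    rw [h2, intervalIntegral.integral_same]
    ring
  have hbot : Tendsto E atBot (𝓝 0) := by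
    rw [show (0 : ℝ) = ∑ i, p i * 0 by simp]
    refine tendsto_finsetSum _ fun i _ => Tendsto.const_mul _ ?_
    refine Metric.tendsto_nhds.2 fun ε hε => ?_
    have h1 := Metric.tendsto_nhds.1 (hz.tendsto_atBot hp hsum hs hh) (ε / (2 * s i))
      (div_pos hε (mul_pos two_pos (hs i)))
    obtain ⟨X, hX⟩ := eventually_atBot.1 h1
    filter_upwards [eventually_le_atBot X] with x hx
    rw [intervalIntegral.integral_interval_sub_left (hII _ _) (hII _ _), dist_zero_right]
    have h2 := intervalIntegral.norm_integral_le_of_norm_le_const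
      (a := x - s i) (b := x) (f := Z) (C := ε / (2 * s i)) fun y hy => by
        rw [Set.uIoc_of_le (by linarith [hs i])] at hy
        have := hX y (hy.2.trans hx)
        rw [dist_zero_right] at this
        exact this.le
    rw [sub_sub_cancel, abs_of_pos (hs i)] at h2
    have h3 : ε / (2 * s i) * s i = ε / 2 := by have := (hs i).ne'; field_simp
    linarith
  have hK : E 0 = ∫ y in Set.Iic (0 : ℝ), z y := by
    have h1 : Tendsto (fun x => E 0 - E x) atBot (𝓝 (E 0 - 0)) := tendsto_const_nhds.sub hbot
    have h2 := intervalIntegral_tendsto_integral_Iic (0 : ℝ) hzi.integrableOn tendsto_id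
    rw [sub_zero] at h1
    refine tendsto_nhds_unique h1 (h2.congr fun x => ?_)
    rw [hconst x, intervalIntegral.integral_symm]
    simp
  have h1 := (intervalIntegral_tendsto_integral_Ioi (0 : ℝ) hzi.integrableOn tendsto_id).add_const
    (E 0)
  rw [hK, add_comm, intervalIntegral.integral_Iic_add_Ioi hzi.integrableOn hzi.integrableOn] at h1
  refine h1.congr fun x => ?_
  rw [hconst x, hK]
  rfl

theorem BlockDominated.tendsto_average (hM : 0 < M) (hp : ∀ i, 0 < p i) (hsum : ∑ i, p i = 1)
    (hs : ∀ i, 0 < s i) {h : ℝ} (hh : 0 < h) (hz : BlockDominated h z)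
    (hm : AEStronglyMeasurable z volume) :
    Tendsto (fun t : ℝ => t⁻¹ * ∫ T in (0 : ℝ)..t, wordSum p s z T) atTop
      (𝓝 (1 / mean p s * ∫ T, z T)) :=
  tendsto_div_of_increments hM hp hsum hs
    (intervalIntegral.continuous_primitive (hz.intervalIntegrable hp hsum hs hh hm) 0)
    (hz.tendsto_increments hp hsum hs hh hm)

/-- A renewal sum that converges at infinity converges to the limit of its averages. -/
lemma BlockDominated.tendsto_of_tendsto (hM : 0 < M) (hp : ∀ i, 0 < p i) (hsum : ∑ i, p i = 1)
    (hs : ∀ i, 0 < s i) {h : ℝ} (hh : 0 < h) (hz : BlockDominated h z)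
    (hm : AEStronglyMeasurable z volume) {c : ℝ} (hc : Tendsto (wordSum p s z) atTop (𝓝 c)) :
    Tendsto (wordSum p s z) atTop (𝓝 (1 / mean p s * ∫ T, z T)) := by
  -- the increments of the primitive over windows of length `s i` tend to `c * s i`
  have hII := hz.intervalIntegrable hp hsum hs hh hm
  have h1 : Tendsto (fun x => ∑ i, p i * ((∫ y in (0 : ℝ)..x, wordSum p s z y)
      - ∫ y in (0 : ℝ)..(x - s i), wordSum p s z y)) atTop (𝓝 (∑ i, p i * (c * s i))) := by
    refine tendsto_finsetSum _ fun i _ => Tendsto.const_mul _ ?_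
    refine Metric.tendsto_nhds.2 fun ε hε => ?_
    obtain ⟨X, hX⟩ := eventually_atTop.1
      (Metric.tendsto_nhds.1 hc (ε / (2 * s i)) (div_pos hε (mul_pos two_pos (hs i))))
    filter_upwards [eventually_ge_atTop (X + s i)] with x hx
    rw [intervalIntegral.integral_interval_sub_left (hII _ _) (hII _ _), dist_eq_norm]
    have h2 := intervalIntegral.norm_integral_le_of_norm_le_const
      (a := x - s i) (b := x) (f := fun y => wordSum p s z y - c) (C := ε / (2 * s i))
      fun y hy => by
        rw [Set.uIoc_of_le (by linarith [hs i])] at hy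
        have := hX y (by linarith [hy.1])
        rw [dist_eq_norm] at this
        exact this.le
    rw [intervalIntegral.integral_sub (hII _ _) intervalIntegrable_const,
      intervalIntegral.integral_const, sub_sub_cancel, abs_of_pos (hs i), smul_eq_mul,
      mul_comm (s i) c] at h2
    have h3 : ε / (2 * s i) * s i = ε / 2 := by have := (hs i).ne'; field_simp
    linarith
  have h2 := tendsto_nhds_unique h1 (hz.tendsto_increments hp hsum hs hh hm)
  have h3 : ∑ i, p i * (c * s i) = c * mean p s := by
    rw [mean, Finset.mul_sum]
    exact Finset.sum_congr rfl fun i _ => by ring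
  have := (mean_pos hM hp hs).ne'
  rw [← h2, h3]
  convert hc using 2
  field_simp

/-! ### Direct Riemann integrability -/

lemma mem_block {h : ℝ} (hh : 0 < h) (t : ℝ) :
    t ∈ Set.Ico ((((⌊t / h⌋ + 1 : ℤ) : ℝ) - 1) * h) (((⌊t / h⌋ + 1 : ℤ) : ℝ) * h) := by
  push_cast
  rw [add_sub_cancel_right, ← setOf_floor_div_eq hh]
  rfl

/-- For small meshes the lower and upper step functions are summable and enclose `z`. Block `k` in
the definition is `[(k - 1) h, k h)`, whence the shift by one. -/
lemma DirectlyRiemannIntegrable.eventually_steps (hz : DirectlyRiemannIntegrable z) :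
    ∀ᶠ h in 𝓝[>] (0 : ℝ), 0 < h ∧ Summable (fun k => lowerBlock z h (k + 1)) ∧
      Summable (fun k => upperBlock z h (k + 1)) ∧
      ∀ t, lowerBlock z h (⌊t / h⌋ + 1) ≤ z t ∧ z t ≤ upperBlock z h (⌊t / h⌋ + 1) := by
  filter_upwards [hz.1, self_mem_nhdsWithin] with h ⟨hb, hl, hu⟩ hh
  have hh' : h ≠ 0 := ne_of_gt hh
  refine ⟨hh, ?_, ?_, fun t => ⟨?_, ?_⟩⟩
  · exact ((summable_mul_left_iff hh').1 hl).comp_injective (Equiv.addRight (1 : ℤ)).injective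
  · exact ((summable_mul_left_iff hh').1 hu).comp_injective (Equiv.addRight (1 : ℤ)).injective
  · exact csInf_le (hb _).1 ⟨t, mem_block hh t, rfl⟩
  · exact le_csSup (hb _).2 ⟨t, mem_block hh t, rfl⟩

lemma tsum_lowerBlock (z : ℝ → ℝ) (h : ℝ) :
    ∑' k, h * lowerBlock z h (k + 1) = lowerSum z h :=
  (Equiv.addRight (1 : ℤ)).tsum_eq fun k => h * lowerBlock z h k

lemma tsum_upperBlock (z : ℝ → ℝ) (h : ℝ) :
    ∑' k, h * upperBlock z h (k + 1) = upperSum z h :=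
  (Equiv.addRight (1 : ℤ)).tsum_eq fun k => h * upperBlock z h k

lemma DirectlyRiemannIntegrable.eventually_blockDominated (hz : DirectlyRiemannIntegrable z) :
    ∀ᶠ h in 𝓝[>] (0 : ℝ), BlockDominated h z := by
  filter_upwards [hz.eventually_steps] with h ⟨_, hl, hu, hlu⟩
  refine ⟨_, hl.abs.add hu.abs, fun t => abs_le.2 ⟨?_, ?_⟩⟩
  · have h1 := (hlu t).1
    have h2 := neg_abs_le (lowerBlock z h (⌊t / h⌋ + 1))
    have h3 := abs_nonneg (upperBlock z h (⌊t / h⌋ + 1))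
    linarith
  · have h1 := (hlu t).2
    have h2 := le_abs_self (upperBlock z h (⌊t / h⌋ + 1))
    have h3 := abs_nonneg (lowerBlock z h (⌊t / h⌋ + 1))
    linarith

/-- A bound at mesh `a / m` gives a bound at mesh `a` by adding the heights over the `m` fine blocks
in each coarse one. -/
lemma BlockDominated.coarsen {a : ℝ} (ha : 0 < a) {m : ℕ} (hm : 0 < m)
    (hz : BlockDominated (a / m) z) : BlockDominated a z := by
  obtain ⟨b, hb, hzb⟩ := hz
  have hm0 : (0 : ℝ) < m := by exact_mod_cast hm
  have hb0 := nonneg_of_blockBound (div_pos ha hm0) hzb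
  refine ⟨fun l => ∑ j ∈ Finset.range m, b (m * l + j),
    summable_sum fun j _ => hb.comp_injective fun k l hkl => ?_, fun t => (hzb t).trans ?_⟩
  · have hmz : (m : ℤ) ≠ 0 := by exact_mod_cast hm.ne'
    exact mul_left_cancel₀ hmz (add_right_cancel hkl)
  · set k := ⌊t / (a / m)⌋ with hk
    have hkl : ⌊t / a⌋ = k / m := by
      rw [hk, ← Int.floor_div_natCast]
      congr 1
      field_simp
    have h0 : 0 ≤ k % m := Int.emod_nonneg _ (by omega)
    have h1 : k % m < m := Int.emod_lt_of_pos _ (by omega)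
    have h2 : b k = b (m * ⌊t / a⌋ + ((k % m).toNat : ℕ)) := by
      rw [Int.toNat_of_nonneg h0, hkl, Int.mul_ediv_add_emod]
    rw [h2]
    exact Finset.single_le_sum (f := fun j : ℕ => b (m * ⌊t / a⌋ + j)) (fun j _ => hb0 _)
      (Finset.mem_range.2 (by omega))

lemma DirectlyRiemannIntegrable.blockDominated (hz : DirectlyRiemannIntegrable z) {a : ℝ}
    (ha : 0 < a) : BlockDominated a z := by
  have h1 : Tendsto (fun m : ℕ => a / m) atTop (𝓝[>] 0) :=
    tendsto_nhdsWithin_iff.2 ⟨tendsto_const_div_atTop_nhds_zero_nat a, by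
      filter_upwards [eventually_gt_atTop 0] with m hm
      exact div_pos ha (by exact_mod_cast hm)⟩
  obtain ⟨m, hm, hm0⟩ :=
    ((h1.eventually hz.eventually_blockDominated).and (eventually_gt_atTop 0)).exists
  exact hm.coarsen ha hm0

lemma measurable_step (c : ℤ → ℝ) (h : ℝ) : Measurable fun x : ℝ => c ⌊x / h⌋ :=
  (measurable_from_top (f := c)).comp (Int.measurable_floor.comp (measurable_id.div_const h))

/-- The gap between the upper and lower step functions tends to zero in mean, hence almost
everywhere along a sequence of meshes, so that `z` is an almost everywhere limit of step
functions. -/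
lemma DirectlyRiemannIntegrable.aestronglyMeasurable (hz : DirectlyRiemannIntegrable z) :
    AEStronglyMeasurable z volume := by
  obtain ⟨L, hL, hU⟩ := hz.2
  obtain ⟨h, hh⟩ := exists_seq_tendsto (𝓝[>] (0 : ℝ))
  have hev := hh.eventually hz.eventually_steps
  set D : ℕ → ℝ → ℝ := fun n x =>
    upperBlock z (h n) (⌊x / h n⌋ + 1) - lowerBlock z (h n) (⌊x / h n⌋ + 1) with hD
  have hDm : ∀ n, AEStronglyMeasurable (D n) volume := fun n =>
    ((measurable_step (fun k => upperBlock z (h n) (k + 1)) (h n)).sub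
      (measurable_step (fun k => lowerBlock z (h n) (k + 1)) (h n))).aestronglyMeasurable
  have hD0 : Tendsto (fun n => eLpNorm (D n - 0) 1 volume) atTop (𝓝 0) := by
    have h1 : Tendsto (fun n => ENNReal.ofReal (upperSum z (h n) - lowerSum z (h n))) atTop
        (𝓝 0) := by
      have := ((hU.comp hh).sub (hL.comp hh))
      rw [sub_self] at this
      simpa [Function.comp_def] using (ENNReal.continuous_ofReal.tendsto 0).comp this
    refine h1.congr' ?_
    filter_upwards [hev] with n ⟨hn, hl, hu, hlu⟩
    have il := integral_step hn hl
    have iu := integral_step hn hu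
    have iD : Integrable (D n) volume := iu.1.sub il.1
    rw [sub_zero, eLpNorm_one_eq_lintegral_enorm, ← ofReal_integral_norm_eq_lintegral_enorm iD]
    congr 1
    rw [← tsum_upperBlock, ← tsum_lowerBlock, ← iu.2, ← il.2, ← integral_sub iu.1 il.1]
    refine integral_congr_ae (Eventually.of_forall fun x => ?_)
    have := hlu x
    exact (Real.norm_of_nonneg (by linarith)).symm
  obtain ⟨ns, hns, hae⟩ := (tendstoInMeasure_of_tendsto_eLpNorm one_ne_zero hDm
    aestronglyMeasurable_zero hD0).exists_seq_tendsto_ae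
  refine aestronglyMeasurable_of_tendsto_ae (u := atTop)
    (f := fun i x => lowerBlock z (h (ns i)) (⌊x / h (ns i)⌋ + 1))
    (fun i => (measurable_step (fun k => lowerBlock z (h (ns i)) (k + 1))
      (h (ns i))).aestronglyMeasurable) ?_
  filter_upwards [hae] with x hx
  rw [tendsto_iff_dist_tendsto_zero]
  refine squeeze_zero' (Eventually.of_forall fun _ => dist_nonneg) ?_ hx
  filter_upwards [hns.tendsto_atTop.eventually hev] with i ⟨_, _, _, hlu⟩
  have := hlu x
  rw [dist_comm, Real.dist_eq, abs_of_nonneg (by linarith)]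
  simp only [hD]
  linarith

lemma DirectlyRiemannIntegrable.integrable (hz : DirectlyRiemannIntegrable z) : Integrable z :=
  (hz.blockDominated one_pos).integrable one_pos hz.aestronglyMeasurable

lemma DirectlyRiemannIntegrable.tendsto_sums (hz : DirectlyRiemannIntegrable z) :
    Tendsto (lowerSum z) (𝓝[>] 0) (𝓝 (∫ t, z t)) ∧
      Tendsto (upperSum z) (𝓝[>] 0) (𝓝 (∫ t, z t)) := by
  obtain ⟨L, hL, hU⟩ := hz.2
  have h1 : ∀ᶠ h in 𝓝[>] (0 : ℝ), lowerSum z h ≤ ∫ t, z t ∧ ∫ t, z t ≤ upperSum z h := by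
    filter_upwards [hz.eventually_steps] with h ⟨hh, hl, hu, hlu⟩
    have il := integral_step hh hl
    have iu := integral_step hh hu
    rw [← tsum_upperBlock, ← tsum_lowerBlock, ← iu.2, ← il.2]
    exact ⟨integral_mono il.1 hz.integrable fun x => (hlu x).1,
      integral_mono hz.integrable iu.1 fun x => (hlu x).2⟩
  have h2 : ∫ t, z t = L := le_antisymm (ge_of_tendsto hU (h1.mono fun _ h => h.2))
    (le_of_tendsto hL (h1.mono fun _ h => h.1))
  rw [h2]
  exact ⟨hL, hU⟩

/-! ### Renewal sums of blocks and step functions -/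

lemma blockDominated_blockIndicator (h : ℝ) : BlockDominated h (blockIndicator h) := by
  refine ⟨fun k => if k = 0 then 1 else 0, (hasSum_ite_eq 0 (1 : ℝ)).summable, fun t => ?_⟩
  rw [abs_of_nonneg (blockIndicator_nonneg h t)]
  rfl

lemma integral_blockIndicator {h : ℝ} (hh : 0 < h) : ∫ t, blockIndicator h t = h := by
  have h1 := (integral_step hh (c := fun k => if k = 0 then 1 else 0)
    (hasSum_ite_eq 0 (1 : ℝ)).summable).2
  rw [show ∫ t, blockIndicator h t = ∫ t, if ⌊t / h⌋ = 0 then (1 : ℝ) else 0 from rfl, h1]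
  simp

lemma aestronglyMeasurable_blockIndicator (h : ℝ) :
    AEStronglyMeasurable (blockIndicator h) volume :=
  (measurable_step (fun k => if k = 0 then 1 else 0) h).aestronglyMeasurable

/-- Blackwell's theorem for one mesh gives the limit of the renewal sum of every summable step
function with that mesh, by dominated convergence. -/
lemma tendsto_wordSum_step (hp : ∀ i, 0 < p i) (hsum : ∑ i, p i = 1) (hs : ∀ i, 0 < s i)
    {h : ℝ} (hh : 0 < h)
    (hV : Tendsto (wordSum p s (blockIndicator h)) atTop (𝓝 (1 / mean p s * h)))
    {c : ℤ → ℝ} (hc : Summable c) :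
    Tendsto (wordSum p s fun x => c ⌊x / h⌋) atTop (𝓝 (1 / mean p s * ∑' k, h * c k)) := by
  obtain ⟨C, hC0, hC⟩ := exists_wordSum_blockIndicator_le hp hsum hs hh
  have h1 := tendsto_tsum_of_dominated_convergence (𝓕 := atTop)
    (f := fun (t : ℝ) (k : ℤ) => c k * wordSum p s (blockIndicator h) (t - k * h))
    (g := fun k => c k * (1 / mean p s * h)) (hc.abs.mul_right C) (fun k => ?_)
    (Eventually.of_forall fun t k => ?_)
  · rw [tsum_mul_right] at h1
    rw [tsum_mul_left]
    convert h1 using 2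
    · exact (summable_step hp hsum hs hh hc _).2
    · ring
  · exact (hV.comp (tendsto_atTop_add_const_right _ (-(k * h)) tendsto_id)).const_mul _
  · rw [norm_mul, Real.norm_eq_abs, Real.norm_eq_abs,
      abs_of_nonneg (wordSum_blockIndicator_nonneg hp _ _)]
    exact mul_le_mul_of_nonneg_left (hC _).2 (abs_nonneg _)

lemma tendsto_of_sandwich {F : ℝ → ℝ} {v : ℝ}
    (hl : ∀ ε > 0, ∃ f l, Tendsto f atTop (𝓝 l) ∧ v - ε < l ∧ ∀ t, f t ≤ F t)
    (hu : ∀ ε > 0, ∃ f l, Tendsto f atTop (𝓝 l) ∧ l < v + ε ∧ ∀ t, F t ≤ f t) :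
    Tendsto F atTop (𝓝 v) := by
  refine Metric.tendsto_nhds.2 fun ε hε => ?_
  obtain ⟨f, l, hf, hlv, hfF⟩ := hl ε hε
  obtain ⟨g, u, hg, huv, hFg⟩ := hu ε hε
  filter_upwards [hf.eventually_const_lt hlv, hg.eventually_lt_const huv] with t h1 h2
  rw [Real.dist_eq, abs_lt]
  constructor <;> linarith [hfF t, hFg t]

/-! ### The non-lattice case -/

/-- Renewal sums of compactly supported Lipschitz functions are Lipschitz at small distances, by
the uniform bound on the renewal measure of intervals. -/
lemma exists_wordSum_lipschitz (hp : ∀ i, 0 < p i) (hsum : ∑ i, p i = 1) (hs : ∀ i, 0 < s i)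
    {f : ℝ → ℝ} {A C K : ℝ} (hC : ∀ t, |f t| ≤ C) (hA : ∀ t, A < |t| → f t = 0)
    (hK : ∀ x y, |f x - f y| ≤ K * |x - y|) :
    ∃ D > 0, ∀ t t', |t - t'| ≤ 1 → |wordSum p s f t - wordSum p s f t'| ≤ D * |t - t'| := by
  have hK0 : 0 ≤ K := by
    have := (abs_nonneg _).trans (hK 1 0)
    simpa using this
  set J : ℝ → ℝ := fun x => if |x| ≤ A + 1 then 1 else 0 with hJ
  have hJd : BlockDominated 1 J := BlockDominated.of_support one_pos (A := A + 1) (C := 1)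
    (fun t => by simp only [hJ]; split_ifs <;> simp)
    (fun t ht => if_neg (not_le.2 ht))
  have hfd : BlockDominated 1 f := BlockDominated.of_support one_pos hC hA
  obtain ⟨C', hC'0, hC'⟩ := hJd.bounded hp hsum hs one_pos
  refine ⟨K * C' + 1, by positivity, fun t t' htt => ?_⟩
  have hJs := hJd.summable hp hsum hs one_pos t
  have hle : ∀ x, |f x - f (x + (t' - t))| ≤ K * |t - t'| * J x := fun x => by
    simp only [hJ]
    split_ifs with hx
    · have := hK x (x + (t' - t))
      rwa [show x - (x + (t' - t)) = t - t' by ring, ← mul_one (K * |t - t'|)] at this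
    · rw [hA x (by linarith), hA (x + (t' - t)), sub_zero, abs_zero, mul_zero]
      have h1 := abs_sub_abs_le_abs_sub x (x + (t' - t))
      rw [show x - (x + (t' - t)) = t - t' by ring] at h1
      linarith
  have heq : wordSum p s f t - wordSum p s f t' = ∑' w,
      (f (t - wordShift s w) - f (t - wordShift s w + (t' - t))) * wordWeight p w := by
    unfold wordSum
    rw [← (hfd.summable hp hsum hs one_pos t).tsum_sub (hfd.summable hp hsum hs one_pos t')]
    refine tsum_congr fun w => ?_
    rw [show t - wordShift s w + (t' - t) = t' - wordShift s w by ring, sub_mul]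
  have h1 : |wordSum p s f t - wordSum p s f t'| ≤ K * |t - t'| * wordSum p s J t := by
    rw [heq, ← Real.norm_eq_abs]
    refine tsum_of_norm_bounded (hJs.hasSum.mul_left (K * |t - t'|)) fun w => ?_
    rw [norm_mul, Real.norm_eq_abs, Real.norm_eq_abs, abs_of_pos (wordWeight_pos hp w),
      ← mul_assoc]
    exact mul_le_mul_of_nonneg_right (hle _) (wordWeight_pos hp w).le
  have h2 : K * |t - t'| * wordSum p s J t ≤ K * |t - t'| * C' :=
    mul_le_mul_of_nonneg_left ((le_abs_self _).trans (hC' t)) (by positivity)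
  nlinarith [abs_nonneg (t - t')]

lemma exists_mem_closure_lt (hlat : ¬ ∃ H : AddSubgroup ℝ, DiscreteTopology H ∧ ∀ i, s i ∈ H)
    {δ : ℝ} (hδ : 0 < δ) : ∃ g ∈ AddSubgroup.closure (Set.range s), 0 < g ∧ g < δ := by
  rcases (AddSubgroup.closure (Set.range s)).dense_or_cyclic with h | ⟨a, ha⟩
  · obtain ⟨g, hg, h0, h1⟩ := h.exists_between hδ
    exact ⟨g, hg, h0, h1⟩
  · rw [← AddSubgroup.zmultiples_eq_closure] at ha
    refine (hlat ⟨AddSubgroup.zmultiples a, inferInstance, fun i => ?_⟩).elim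
    rw [← ha]
    exact AddSubgroup.subset_closure ⟨i, rfl⟩

lemma tendsto_wordSum_of_lipschitz (hM : 0 < M) (hp : ∀ i, 0 < p i) (hsum : ∑ i, p i = 1)
    (hs : ∀ i, 0 < s i)
    (hlat : ¬ ∃ H : AddSubgroup ℝ, DiscreteTopology H ∧ ∀ i, s i ∈ H)
    {f : ℝ → ℝ} {A C K : ℝ} (hC : ∀ t, |f t| ≤ C) (hA : ∀ t, A < |t| → f t = 0)
    (hK : ∀ x y, |f x - f y| ≤ K * |x - y|) (hf : Continuous f) :
    Tendsto (wordSum p s f) atTop (𝓝 (1 / mean p s * ∫ t, f t)) := by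
  have hfd : BlockDominated 1 f := BlockDominated.of_support one_pos hC hA
  obtain ⟨B, -, hB⟩ := hfd.bounded hp hsum hs one_pos
  obtain ⟨S, hS0, hS⟩ := exists_step_le s
  obtain ⟨D, hD0, hD⟩ := exists_wordSum_lipschitz hp hsum hs hC hA hK
  obtain ⟨c, hc⟩ := exists_tendsto_of_homogeneous hp hsum hs (T₀ := A + 1) hB hS
    (fun t ht => by
      rw [hfd.renewal_equation hp hsum hs one_pos, hA t (lt_of_lt_of_le (by linarith)
        (le_abs_self t)), add_zero])
    (fun ε hε => by
      obtain ⟨g, hg, hg0, hgδ⟩ := exists_mem_closure_lt hlat (δ := min 1 (ε / D))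
        (lt_min one_pos (div_pos hε hD0))
      obtain ⟨R, hR⟩ := exists_wordShift_mem_Ioc hM hs hg hg0
      refine ⟨R, R + S, fun t u hu1 hu2 => ?_⟩
      obtain ⟨w, hw1, hw2⟩ := hR u hu1
      refine ⟨w, by linarith, ?_⟩
      have h1 : |t - u - (t - wordShift s w)| ≤ min 1 (ε / D) := by
        rw [abs_le]; constructor <;> linarith
      refine (hD _ _ (h1.trans (min_le_left _ _))).trans ?_
      rw [← le_div_iff₀' hD0]
      exact h1.trans (min_le_right _ _))
  exact hfd.tendsto_of_tendsto hM hp hsum hs one_pos hf.aestronglyMeasurable hc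

/-- The trapezoidal function equal to `1` on `[c - r, c + r]` and to `0` outside
`[c - r - δ, c + r + δ]`. -/
noncomputable def plateau (c r δ x : ℝ) : ℝ := max 0 (min 1 ((r + δ - |x - c|) / δ))

lemma plateau_nonneg (c r δ x : ℝ) : 0 ≤ plateau c r δ x := le_max_left _ _

lemma plateau_le_one (c r δ x : ℝ) : plateau c r δ x ≤ 1 :=
  max_le zero_le_one (min_le_left _ _)

lemma plateau_eq_one {c r δ x : ℝ} (hδ : 0 < δ) (hx : |x - c| ≤ r) : plateau c r δ x = 1 := by
  rw [plateau, min_eq_left, max_eq_right zero_le_one]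
  rw [le_div_iff₀ hδ]; linarith

lemma plateau_eq_zero {c r δ x : ℝ} (hδ : 0 < δ) (hx : r + δ ≤ |x - c|) :
    plateau c r δ x = 0 := by
  rw [plateau, max_eq_left]
  exact (min_le_right _ _).trans (div_nonpos_of_nonpos_of_nonneg (by linarith) hδ.le)

lemma continuous_plateau (c r δ : ℝ) : Continuous (plateau c r δ) := by
  unfold plateau; fun_prop

lemma abs_plateau_sub_le {c r δ : ℝ} (hδ : 0 < δ) (x y : ℝ) :
    |plateau c r δ x - plateau c r δ y| ≤ 1 / δ * |x - y| := by
  have h1 : |plateau c r δ x - plateau c r δ y|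
      ≤ |(r + δ - |x - c|) / δ - (r + δ - |y - c|) / δ| := by
    unfold plateau
    rw [max_comm 0, max_comm 0, min_comm 1, min_comm 1]
    refine (abs_max_sub_max_le_abs _ _ _).trans ?_
    simpa using abs_min_sub_min_le_max ((r + δ - |x - c|) / δ) 1 ((r + δ - |y - c|) / δ) 1
  refine h1.trans ?_
  rw [← sub_div, abs_div, abs_of_pos hδ, div_eq_inv_mul, one_div]
  refine mul_le_mul_of_nonneg_left ?_ (inv_nonneg.2 hδ.le)
  rw [show r + δ - |x - c| - (r + δ - |y - c|) = |y - c| - |x - c| by ring]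
  have := abs_abs_sub_abs_le_abs_sub (y - c) (x - c)
  rwa [sub_sub_sub_cancel_right, abs_sub_comm y x] at this

lemma integral_plateau_bounds {c r δ : ℝ} (hδ : 0 < δ) (hr : 0 ≤ r) :
    2 * r ≤ ∫ x, plateau c r δ x ∧ ∫ x, plateau c r δ x ≤ 2 * (r + δ) := by
  have hI : ∀ ρ : ℝ, 0 ≤ ρ → Integrable ((Set.Icc (c - ρ) (c + ρ)).indicator fun _ => (1 : ℝ)) ∧
      ∫ x, (Set.Icc (c - ρ) (c + ρ)).indicator (fun _ => (1 : ℝ)) x = 2 * ρ := fun ρ hρ => by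
    refine ⟨(integrable_indicator_iff measurableSet_Icc).2
      (integrableOn_const (by simp)), ?_⟩
    rw [integral_indicator measurableSet_Icc, setIntegral_const, Real.volume_real_Icc_of_le
      (by linarith), smul_eq_mul]
    ring
  have hup : ∀ x, plateau c r δ x
      ≤ (Set.Icc (c - (r + δ)) (c + (r + δ))).indicator (fun _ => (1 : ℝ)) x := fun x => by
    by_cases hx : |x - c| ≤ r + δ
    · rw [Set.indicator_of_mem]
      · exact plateau_le_one c r δ x
      · rw [abs_le] at hx
        exact ⟨by linarith, by linarith⟩
    · rw [plateau_eq_zero hδ (not_le.1 hx).le]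
      exact Set.indicator_nonneg (fun _ _ => zero_le_one) x
  have hlo : ∀ x, (Set.Icc (c - r) (c + r)).indicator (fun _ => (1 : ℝ)) x
      ≤ plateau c r δ x := fun x => by
    by_cases hx : x ∈ Set.Icc (c - r) (c + r)
    · rw [Set.indicator_of_mem hx, plateau_eq_one hδ]
      exact abs_le.2 ⟨by linarith [hx.1], by linarith [hx.2]⟩
    · rw [Set.indicator_of_notMem hx]
      exact plateau_nonneg c r δ x
  have hint : Integrable (plateau c r δ) := (hI (r + δ) (by linarith)).1.mono'
    (continuous_plateau c r δ).aestronglyMeasurable (Eventually.of_forall fun x => by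
      rw [Real.norm_of_nonneg (plateau_nonneg c r δ x)]; exact hup x)
  rw [← (hI r hr).2, ← (hI (r + δ) (by linarith)).2]
  exact ⟨integral_mono (hI r hr).1 hint hlo, integral_mono hint (hI (r + δ) (by linarith)).1 hup⟩

/-- Blackwell's renewal theorem in the non-lattice case, by sandwiching the indicator function of a
block between trapezoids. -/
lemma tendsto_wordSum_blockIndicator (hM : 0 < M) (hp : ∀ i, 0 < p i) (hsum : ∑ i, p i = 1)
    (hs : ∀ i, 0 < s i)
    (hlat : ¬ ∃ H : AddSubgroup ℝ, DiscreteTopology H ∧ ∀ i, s i ∈ H) {h : ℝ} (hh : 0 < h) :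
    Tendsto (wordSum p s (blockIndicator h)) atTop (𝓝 (1 / mean p s * h)) := by
  have hμ := mean_pos hM hp hs
  have hsupp : ∀ r δ, 0 < δ → ∀ t, h / 2 + |r| + δ < |t| → plateau (h / 2) r δ t = 0 := by
    intro r δ hδ t ht
    refine plateau_eq_zero hδ ?_
    have h1 := abs_sub_abs_le_abs_sub t (h / 2)
    rw [abs_of_pos (half_pos hh)] at h1
    linarith [le_abs_self r]
  have hone : ∀ r δ t, |plateau (h / 2) r δ t| ≤ 1 := fun r δ t => by
    rw [abs_of_nonneg (plateau_nonneg _ _ _ _)]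
    exact plateau_le_one _ _ _ _
  have hconv : ∀ r δ, 0 < δ → Tendsto (wordSum p s (plateau (h / 2) r δ)) atTop
      (𝓝 (1 / mean p s * ∫ t, plateau (h / 2) r δ t)) := fun r δ hδ =>
    tendsto_wordSum_of_lipschitz hM hp hsum hs hlat (hone r δ) (hsupp r δ hδ)
      (abs_plateau_sub_le hδ) (continuous_plateau _ _ _)
  have hsm : ∀ r δ, 0 < δ → ∀ t, Summable
      (fun w => plateau (h / 2) r δ (t - wordShift s w) * wordWeight p w) := fun r δ hδ =>
    (BlockDominated.of_support hh (hone r δ) (hsupp r δ hδ)).summable hp hsum hs hh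
  have hsmV := (blockDominated_blockIndicator h).summable hp hsum hs hh
  refine tendsto_of_sandwich (fun ε hε => ?_) (fun ε hε => ?_)
  · obtain ⟨δ, hδ0, hδ⟩ := exists_between (lt_min (half_pos hh)
      (show 0 < ε * mean p s / 2 by positivity))
    have hδ1 := hδ.trans_le (min_le_left _ _)
    have hδ2 := hδ.trans_le (min_le_right _ _)
    refine ⟨_, _, hconv (h / 2 - δ) δ hδ0, ?_, fun t =>
      wordSum_mono hp (fun x => ?_) (hsm _ _ hδ0 t) (hsmV t)⟩
    · have h1 := (integral_plateau_bounds (c := h / 2) hδ0 (by linarith : 0 ≤ h / 2 - δ)).1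
      calc 1 / mean p s * h - ε = 1 / mean p s * (h - ε * mean p s) := by field_simp
        _ < _ := mul_lt_mul_of_pos_left (by linarith) (by positivity)
    · by_cases hx : 0 ≤ x ∧ x < h
      · rw [blockIndicator_of_mem hh hx.1 hx.2]
        exact plateau_le_one _ _ _ _
      · rw [plateau_eq_zero hδ0]
        · exact blockIndicator_nonneg h x
        · by_contra! h'
          rw [abs_lt] at h'
          exact hx ⟨by linarith, by linarith⟩
  · set δ := ε * mean p s / 4 with hδ
    have hδ0 : 0 < δ := by positivity
    refine ⟨_, _, hconv (h / 2) δ hδ0, ?_, fun t =>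
      wordSum_mono hp (fun x => ?_) (hsmV t) (hsm _ _ hδ0 t)⟩
    · have h1 := (integral_plateau_bounds (c := h / 2) hδ0 (half_pos hh).le).2
      have h2 : 0 < ε * mean p s := by positivity
      calc _ < 1 / mean p s * (h + ε * mean p s) :=
            mul_lt_mul_of_pos_left (by linarith) (by positivity)
        _ = 1 / mean p s * h + ε := by field_simp
    · by_cases hx : 0 ≤ x ∧ x < h
      · rw [plateau_eq_one hδ0 (abs_le.2 ⟨by linarith, by linarith⟩)]
        unfold blockIndicator
        split_ifs <;> norm_num
      · rw [blockIndicator_of_notMem hh (by by_contra! h'; exact hx h')]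
        exact plateau_nonneg _ _ _ _

/-- The key renewal theorem in the non-lattice case: the renewal sum of `z` lies between those of
its lower and upper step functions. -/
theorem DirectlyRiemannIntegrable.tendsto_wordSum (hM : 0 < M) (hp : ∀ i, 0 < p i)
    (hsum : ∑ i, p i = 1) (hs : ∀ i, 0 < s i)
    (hlat : ¬ ∃ H : AddSubgroup ℝ, DiscreteTopology H ∧ ∀ i, s i ∈ H)
    (hz : DirectlyRiemannIntegrable z) :
    Tendsto (wordSum p s z) atTop (𝓝 (1 / mean p s * ∫ t, z t)) := by
  obtain ⟨hL, hU⟩ := hz.tendsto_sums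
  have hsm := (hz.blockDominated one_pos).summable hp hsum hs one_pos
  refine tendsto_of_sandwich (fun ε hε => ?_) (fun ε hε => ?_)
  · obtain ⟨h, h1, hh, hl, -, hlu⟩ := (((hL.const_mul (1 / mean p s)).eventually_const_lt
      (sub_lt_self _ hε)).and hz.eventually_steps).exists
    rw [← tsum_lowerBlock] at h1
    exact ⟨_, _, tendsto_wordSum_step hp hsum hs hh
      (tendsto_wordSum_blockIndicator hM hp hsum hs hlat hh) hl, h1, fun t =>
      wordSum_mono hp (fun x => (hlu x).1) (summable_step hp hsum hs hh hl t).1 (hsm t)⟩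
  · obtain ⟨h, h1, hh, -, hu, hlu⟩ := (((hU.const_mul (1 / mean p s)).eventually_lt_const
      (lt_add_of_pos_right _ hε)).and hz.eventually_steps).exists
    rw [← tsum_upperBlock] at h1
    exact ⟨_, _, tendsto_wordSum_step hp hsum hs hh
      (tendsto_wordSum_blockIndicator hM hp hsum hs hlat hh) hu, h1, fun t =>
      wordSum_mono hp (fun x => (hlu x).2) (hsm t) (summable_step hp hsum hs hh hu t).1⟩

/-! ### The lattice case -/

lemma exists_wordShift_eq_mul {a : ℝ} (ha : ∀ i, ∃ k : ℤ, s i = a * k)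
    (w : (n : ℕ) × (Fin n → Fin M)) : ∃ m : ℤ, wordShift s w = m * a := by
  choose k hk using ha
  refine ⟨∑ j, k (w.2 j), ?_⟩
  rw [wordShift, Int.cast_sum, Finset.sum_mul]
  exact Finset.sum_congr rfl fun j _ => by rw [hk, mul_comm]

/-- The maximal span generates the same group as the steps. -/
lemma mem_closure_of_isGreatest (hM : 0 < M) (hs : ∀ i, 0 < s i) {a : ℝ}
    (ha : IsGreatest {b : ℝ | 0 < b ∧ ∀ i, ∃ k : ℤ, s i = b * (k : ℝ)} a) :
    a ∈ AddSubgroup.closure (Set.range s) := by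
  obtain ⟨⟨ha0, hak⟩, hmax⟩ := ha
  set G := AddSubgroup.closure (Set.range s) with hG
  have hGa : G ≤ AddSubgroup.zmultiples a := by
    rw [hG, AddSubgroup.closure_le]
    rintro _ ⟨i, rfl⟩
    obtain ⟨k, hk⟩ := hak i
    exact AddSubgroup.mem_zmultiples_iff.2 ⟨k, by rw [hk, zsmul_eq_mul, mul_comm]⟩
  -- positive elements of a subgroup of `a ℤ` are at least `a`
  have hge : ∀ g ∈ G, 0 < g → a ≤ g := fun g hg hg0 => by
    obtain ⟨k, rfl⟩ := AddSubgroup.mem_zmultiples_iff.1 (hGa hg)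
    rw [zsmul_eq_mul] at hg0 ⊢
    have hk : 0 < k := by exact_mod_cast pos_of_mul_pos_left hg0 ha0.le
    have hk1 : (1 : ℝ) ≤ k := by exact_mod_cast hk
    nlinarith
  rcases G.dense_or_cyclic with h | ⟨b, hb⟩
  · obtain ⟨g, hg, h0, h1⟩ := h.exists_between ha0
    exact absurd (hge g hg h0) (not_le.2 h1)
  · have hbG : b ∈ G := by rw [hb]; exact AddSubgroup.subset_closure rfl
    have hbk : ∀ i, ∃ k : ℤ, s i = b * k := fun i => by
      have h1 : s i ∈ G := AddSubgroup.subset_closure ⟨i, rfl⟩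
      rw [hb, ← AddSubgroup.zmultiples_eq_closure] at h1
      obtain ⟨k, hk⟩ := AddSubgroup.mem_zmultiples_iff.1 h1
      exact ⟨k, by rw [← hk, zsmul_eq_mul, mul_comm]⟩
    have hb0 : b ≠ 0 := by
      rintro rfl
      obtain ⟨k, hk⟩ := hbk ⟨0, hM⟩
      exact (hs ⟨0, hM⟩).ne' (by rw [hk, zero_mul])
    have habs : |b| ∈ G := by
      rcases abs_choice b with h | h <;> rw [h]
      exacts [hbG, neg_mem hbG]
    have hle : |b| ≤ a := hmax ⟨abs_pos.2 hb0, fun i => by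
      obtain ⟨k, hk⟩ := hbk i
      rcases abs_choice b with h | h <;> rw [h]
      exacts [⟨k, hk⟩, ⟨-k, by rw [hk]; push_cast; ring⟩]⟩
    rwa [le_antisymm hle (hge _ habs (abs_pos.2 hb0))] at habs

/-- The renewal theorem of Erdős, Feller and Pollard: in the lattice case the renewal measure of
blocks whose length is the span converges. -/
lemma tendsto_wordSum_blockIndicator_lattice (hM : 0 < M) (hp : ∀ i, 0 < p i)
    (hsum : ∑ i, p i = 1) (hs : ∀ i, 0 < s i) {a : ℝ}
    (ha : IsGreatest {b : ℝ | 0 < b ∧ ∀ i, ∃ k : ℤ, s i = b * (k : ℝ)} a) :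
    Tendsto (wordSum p s (blockIndicator a)) atTop (𝓝 (1 / mean p s * a)) := by
  have ha0 : 0 < a := ha.1.1
  have hd := blockDominated_blockIndicator a
  have hfloor : ∀ x y : ℝ, ⌊x / a⌋ = ⌊y / a⌋ →
      wordSum p s (blockIndicator a) x = wordSum p s (blockIndicator a) y := fun x y hxy => by
    refine tsum_congr fun w => ?_
    obtain ⟨m, hm⟩ := exists_wordShift_eq_mul ha.1.2 w
    rw [hm, blockIndicator_sub ha0, blockIndicator_sub ha0, hxy]
  obtain ⟨B, -, hB⟩ := hd.bounded hp hsum hs ha0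
  obtain ⟨S, hS0, hS⟩ := exists_step_le s
  obtain ⟨R, hR⟩ := exists_wordShift_mem_Ioc hM hs (mem_closure_of_isGreatest hM hs ha) ha0
  obtain ⟨c, hc⟩ := exists_tendsto_of_homogeneous hp hsum hs (T₀ := a) hB hS
    (fun t ht => by
      rw [hd.renewal_equation hp hsum hs ha0, blockIndicator_of_notMem ha0 (.inr ht), add_zero])
    (fun ε hε => by
      refine ⟨R, R + S + a, fun t u hu1 hu2 => ?_⟩
      -- aim at the left end of the block of `t - u`
      set k := ⌊(t - u) / a⌋ with hk
      have hk1 : k * a ≤ t - u := by rw [← le_div_iff₀ ha0]; exact Int.floor_le _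
      have hk2 : t - u < (k + 1) * a := by rw [← div_lt_iff₀ ha0]; exact Int.lt_floor_add_one _
      obtain ⟨w, hw1, hw2⟩ := hR (t - k * a) (by linarith)
      refine ⟨w, by linarith, ?_⟩
      rw [hfloor (t - u) (t - wordShift s w), sub_self, abs_zero]
      · exact hε.le
      · rw [← hk, eq_comm, Int.floor_eq_iff, le_div_iff₀ ha0, div_lt_iff₀ ha0]
        constructor <;> linarith)
  have := hd.tendsto_of_tendsto hM hp hsum hs ha0 (aestronglyMeasurable_blockIndicator a) hc
  rwa [integral_blockIndicator ha0] at this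

lemma floor_add_mul_div {a : ℝ} (ha : 0 < a) (t : ℝ) (l : ℤ) :
    ⌊(a * l + t) / a⌋ = l + ⌊t / a⌋ := by
  rw [add_div, mul_div_cancel_left₀ _ ha.ne', Int.floor_intCast_add]

lemma BlockDominated.summable_translates {a : ℝ} (ha : 0 < a) (hz : BlockDominated a z) (t : ℝ) :
    Summable fun l : ℤ => z (a * l + t) := by
  obtain ⟨b, hb, hzb⟩ := hz
  refine Summable.of_norm_bounded (g := fun l => b (l + ⌊t / a⌋))
    (hb.comp_injective (Equiv.addRight ⌊t / a⌋).injective) fun l => ?_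
  rw [← floor_add_mul_div ha]
  exact hzb _

/-- In the lattice case the renewal sum at `t` is a sum over the lattice coset of `t`, indexed here
by the offset `l` from the representative `τ = t - a ⌊t / a⌋` of the coset. -/
lemma BlockDominated.wordSum_lattice (hp : ∀ i, 0 < p i) (hsum : ∑ i, p i = 1)
    (hs : ∀ i, 0 < s i) {a : ℝ} (ha : 0 < a) (hak : ∀ i, ∃ k : ℤ, s i = a * k)
    (hz : BlockDominated a z) (t : ℝ) :
    wordSum p s z t = ∑' l : ℤ, z (a * l + (t - ⌊t / a⌋ * a)) *
      wordSum p s (blockIndicator a) (⌊t / a⌋ * a - l * a) := by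
  rw [← (summable_step hp hsum hs ha
    (hz.summable_translates ha (t - ⌊t / a⌋ * a)) (⌊t / a⌋ * a)).2]
  refine tsum_congr fun w => ?_
  obtain ⟨m, hm⟩ := exists_wordShift_eq_mul hak w
  dsimp only
  rw [hm, ← sub_mul, mul_div_cancel_right₀ _ ha.ne', ← Int.cast_sub, Int.floor_intCast]
  congr 2
  push_cast
  ring

/-- The key renewal theorem in the lattice case. -/
theorem BlockDominated.tendsto_sub_latticeLimit (hM : 0 < M) (hp : ∀ i, 0 < p i)
    (hsum : ∑ i, p i = 1) (hs : ∀ i, 0 < s i) {a : ℝ}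
    (ha : IsGreatest {b : ℝ | 0 < b ∧ ∀ i, ∃ k : ℤ, s i = b * (k : ℝ)} a)
    (hz : BlockDominated a z) :
    Tendsto (fun t => wordSum p s z t - latticeLimit p s z a t) atTop (𝓝 0) := by
  have ha0 : 0 < a := ha.1.1
  have hV := tendsto_wordSum_blockIndicator_lattice hM hp hsum hs ha
  obtain ⟨C, hC0, hC⟩ := exists_wordSum_blockIndicator_le hp hsum hs ha0
  set V := wordSum p s (blockIndicator a) with hVdef
  obtain ⟨b, hb, hzb⟩ := id hz
  have hμ := mean_pos hM hp hs
  have hfl : ∀ t : ℝ, ⌊(t - ⌊t / a⌋ * a) / a⌋ = 0 := fun t => by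
    rw [sub_div, mul_div_cancel_right₀ _ ha0.ne', Int.floor_sub_intCast, sub_self]
  have hτ : ∀ (t : ℝ) (l : ℤ), |z (a * l + (t - ⌊t / a⌋ * a))| ≤ b l := fun t l => by
    have := hzb (a * l + (t - ⌊t / a⌋ * a))
    rwa [floor_add_mul_div ha0, hfl, add_zero] at this
  have hdiff : ∀ (t : ℝ) (l : ℤ), |V (⌊t / a⌋ * a - l * a) - 1 / mean p s * a|
      ≤ C + 1 / mean p s * a := fun t l => by
    have h1 := (hC (⌊t / a⌋ * a - l * a)).2
    have h2 : 0 ≤ V (⌊t / a⌋ * a - l * a) := wordSum_blockIndicator_nonneg hp _ _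
    have h3 : 0 < 1 / mean p s * a := by positivity
    rw [abs_le]
    constructor <;> linarith
  have heq : ∀ t, wordSum p s z t - latticeLimit p s z a t
      = ∑' l : ℤ, z (a * l + (t - ⌊t / a⌋ * a)) *
        (V (⌊t / a⌋ * a - l * a) - 1 / mean p s * a) := fun t => by
    have hsm := hz.summable_translates ha0 (t - ⌊t / a⌋ * a)
    have h1 : latticeLimit p s z a t
        = ∑' l : ℤ, z (a * l + (t - ⌊t / a⌋ * a)) * (1 / mean p s * a) := by
      rw [tsum_mul_right, latticeLimit,
        ← (Equiv.addRight ⌊t / a⌋).tsum_eq fun l : ℤ => z (a * l + (t - ⌊t / a⌋ * a)), mul_comm]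
      congr 1
      · refine tsum_congr fun l => congrArg z ?_
        rw [Equiv.coe_addRight]
        push_cast
        ring
      · ring
    rw [h1, hz.wordSum_lattice hp hsum hs ha0 ha.1.2, ← Summable.tsum_sub _ (hsm.mul_right _)]
    · exact tsum_congr fun l => (mul_sub _ _ _).symm
    · refine Summable.of_norm_bounded (g := fun l => b l * C) (hb.mul_right C) fun l => ?_
      rw [norm_mul, Real.norm_eq_abs, Real.norm_eq_abs,
        abs_of_nonneg (wordSum_blockIndicator_nonneg hp _ _)]
      exact mul_le_mul (hτ t l) (hC _).2 (wordSum_blockIndicator_nonneg hp _ _)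
        (nonneg_of_blockBound ha0 hzb l)
  simp only [heq]
  have hlim := tendsto_tsum_of_dominated_convergence (𝓕 := atTop)
    (f := fun (t : ℝ) (l : ℤ) => z (a * l + (t - ⌊t / a⌋ * a)) *
        (V (⌊t / a⌋ * a - l * a) - 1 / mean p s * a))
    (g := fun _ => 0) (hb.mul_right (C + 1 / mean p s * a)) (fun l => ?_)
    (Eventually.of_forall fun t l => ?_)
  · simpa using hlim
  · have h1 : Tendsto (fun t : ℝ => (⌊t / a⌋ : ℝ) * a - l * a) atTop atTop := by
      refine tendsto_atTop_mono (f := fun t => t + (-a - l * a)) (fun t => ?_)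
        (tendsto_atTop_add_const_right _ _ tendsto_id)
      have := Int.lt_floor_add_one (t / a)
      rw [div_lt_iff₀ ha0] at this
      linarith
    have h2 : Tendsto (fun t : ℝ => b l * |V (⌊t / a⌋ * a - l * a) - 1 / mean p s * a|) atTop
        (𝓝 0) := by
      have := (((hV.comp h1).sub_const (1 / mean p s * a)).abs).const_mul (b l)
      simpa using this
    refine squeeze_zero_norm (fun t => ?_) h2
    rw [norm_mul, Real.norm_eq_abs, Real.norm_eq_abs]
    exact mul_le_mul_of_nonneg_right (hτ t l) (abs_nonneg _)
  · rw [norm_mul, Real.norm_eq_abs, Real.norm_eq_abs]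
    exact mul_le_mul (hτ t l) (hdiff t l) (abs_nonneg _) (nonneg_of_blockBound ha0 hzb l)

/-- Along points where `G` stays away from zero, an additive error tending to zero is also a
vanishing relative error. -/
lemma isEquivalent_of_tendsto_sub {F G : ℝ → ℝ} (h : Tendsto (fun t => F t - G t) atTop (𝓝 0))
    {c : ℝ} (hc : 0 < c) : F ~[atTop ⊓ 𝓟 {t : ℝ | c ≤ |G t|}] G := by
  refine isLittleO_iff.2 fun ε hε => ?_
  have h1 := Metric.tendsto_nhds.1 h (ε * c) (mul_pos hε hc)
  rw [eventually_inf_principal]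
  filter_upwards [h1] with t ht hct
  rw [dist_zero_right] at ht
  exact ht.le.trans (mul_le_mul_of_nonneg_left hct hε.le)

end KeyRenewal

theorem corollary3p4 (M : ℕ) (hM : 2 ≤ M) (p s : Fin M → ℝ)
    (hp : ∀ i, 0 < p i ∧ p i < 1) (hp_sum : ∑ i, p i = 1) (hs : ∀ i, 0 < s i)
    (z : ℝ → ℝ) (hz : KeyRenewal.DirectlyRiemannIntegrable z)
    (hdecay : ∃ C > (0 : ℝ), ∃ r > (0 : ℝ), ∀ t < (0 : ℝ), z t ≤ C * Real.exp (r * t)) :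
    -- the series defining `Z` converges absolutely (over all finite words) and `Z` solves the
    -- renewal equation
    ((∀ t : ℝ,
        Summable (fun w : (n : ℕ) × (Fin n → Fin M) =>
          z (t - ∑ j, s (w.2 j)) * ∏ j, p (w.2 j)) ∧
        KeyRenewal.renewalFunction p s z t =
          ∑ i, KeyRenewal.renewalFunction p s z (t - s i) * p i + z t) ∧
      Integrable z volume) ∧
    -- non-lattice case
    ((¬ ∃ H : AddSubgroup ℝ, DiscreteTopology H ∧ ∀ i, s i ∈ H) →
      Tendsto (KeyRenewal.renewalFunction p s z) atTop
        (𝓝 (1 / KeyRenewal.mean p s * ∫ T, z T)) ∧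
      ((∫ T, z T) ≠ 0 →
        KeyRenewal.renewalFunction p s z ~[atTop]
          fun _ => 1 / KeyRenewal.mean p s * ∫ T, z T)) ∧
    -- lattice case with maximal span `a`
    (∀ a : ℝ, IsGreatest {b : ℝ | 0 < b ∧ ∀ i, ∃ k : ℤ, s i = b * (k : ℝ)} a →
      (∀ t : ℝ, Summable (fun l : ℤ => z (a * (l : ℝ) + t))) ∧
      Tendsto
        (fun t => KeyRenewal.renewalFunction p s z t - KeyRenewal.latticeLimit p s z a t)
        atTop (𝓝 0) ∧
      ∀ c > (0 : ℝ),
        KeyRenewal.renewalFunction p s z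
          ~[atTop ⊓ 𝓟 {t : ℝ | c ≤ |KeyRenewal.latticeLimit p s z a t|}]
            KeyRenewal.latticeLimit p s z a) ∧
    -- Cesaro averages
    ((∀ t : ℝ, IntervalIntegrable (KeyRenewal.renewalFunction p s z) volume 0 t) ∧
      Tendsto (fun t : ℝ => t⁻¹ * ∫ T in (0 : ℝ)..t, KeyRenewal.renewalFunction p s z T) atTop
        (𝓝 (1 / KeyRenewal.mean p s * ∫ T, z T))) := by
  have hp0 : ∀ i, 0 < p i := fun i => (hp i).1
  have hM0 : 0 < M := by omega
  have hd := hz.blockDominated one_pos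
  have hm := hz.aestronglyMeasurable
  have hsm := hd.summable hp0 hp_sum hs one_pos
  have hZ : KeyRenewal.renewalFunction p s z = KeyRenewal.wordSum p s z :=
    funext fun t => KeyRenewal.renewalFunction_eq_wordSum (hsm t)
  rw [hZ]
  refine ⟨⟨fun t => ⟨hsm t, ?_⟩, hz.integrable⟩, fun hlat => ?_, fun a ha => ?_,
    fun t => hd.intervalIntegrable hp0 hp_sum hs one_pos hm 0 t,
    hd.tendsto_average hM0 hp0 hp_sum hs one_pos hm⟩
  · simp only [mul_comm _ (p _)]
    exact hd.renewal_equation hp0 hp_sum hs one_pos t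
  · have h := hz.tendsto_wordSum hM0 hp0 hp_sum hs hlat
    have hμ := KeyRenewal.mean_pos hM0 hp0 hs
    exact ⟨h, fun h0 => (isEquivalent_const_iff_tendsto (by positivity)).2 h⟩
  · have hda := hz.blockDominated ha.1.1
    have h := hda.tendsto_sub_latticeLimit hM0 hp0 hp_sum hs ha
    exact ⟨hda.summable_translates ha.1.1, h,
      fun c hc => KeyRenewal.isEquivalent_of_tendsto_sub h hc⟩
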